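/- **Setting.** The language of the logic QHC has countably many individual variables (and no other terms) and two sorts of formulas. *c-formulas* are built from $\top,\bot$ and atoms $p(x_1,\dots,x_n)$ ($p$ an $n$-ary proper predicate variable) by the classical connectives and quantifiers; *i-formulas* are built from $\checkmark$ (triviality), absurdity (written $\bot$ as well below) and atoms $\alpha(x_1,\dots,x_n)$ ($\alpha$ an $n$-ary problem variable) by the intuitionistic connectives and quantifiers; moreover $?\Phi$ is a c-formula for each i-formula $\Phi$, and $!F$ is an i-formula for each c-formula $F$. There are countably many $n$-ary predicate variables of each sort for each $n\ge 0$. Put $\neg A:=A\to\bot$, $\Box F:={?}{!}F$ and $\nabla\Phi:={!}{?}\Phi$. *Meta-formulas* are built from formulas of both sorts by meta-conjunction $\&$, meta-implication $\Rightarrow$ and universal meta-quantifiers over individual variables and over predicate variables. They are derived by the introduction and elimination rules of natural deduction for these (a predicate variable is instantiated by an arbitrary formula of its sort, possibly with parameters, without capture of variables) and by $\alpha$-conversion. A *rule* $F_1,\dots,F_m/G$ is the meta-formula obtained from $\overline{F_1}\,\&\dots\&\,\overline{F_m}\Rightarrow\overline{G}$ by meta-quantification over all its predicate variables, where the bar denotes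 meta-quantification over the free individual variables; a *principle* is a rule without premisses, so it is a formula $G$ meta-quantified over all its variables. The derivation system of QHC is the meta-conjunction of: all laws and inference rules of classical predicate logic for c-formulas; all laws and inference rules of intuitionistic predicate logic for i-formulas; the principles $?(\gamma\land\delta)\leftrightarrow{?}\gamma\land{?}\delta$, $\;?(\gamma\lor\delta)\leftrightarrow{?}\gamma\lor{?}\delta$, $\;?(\gamma\to\delta)\to({?}\gamma\to{?}\delta)$, $\;\neg{?}\bot$, $\;?\exists x\,\theta(x)\leftrightarrow\exists x\,{?}\theta(x)$, $\;?\forall x\,\theta(x)\to\forall x\,{?}\theta(x)$, $\;\gamma\to{!}{?}\gamma$, $\;\neg{!}\bot$, $\;{?}{!}p\to p$, $\;{!}p\to{!}{?}{!}p$, $\;{!}(p\to q)\to({!}p\to{!}q)$; and the rules ${!}p/p$ and $p/{!}p$. A meta-formula $\mathcal F$ is *derivable in QHC* if (derivation system of QHC) $\Rightarrow\mathcal F$ is derivable by the meta-rules, and $\mathcal F$ *implies* $\mathcal G$ if $\mathcal F\Rightarrow\mathcal G$ is derivable in QHC. Consider the following nine principles and one rule: - H: $\;?(\gamma\lor\neg\gamma)$;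 - K: $\;\neg{!}\neg p\to{!}p$; - PC: $\;\nabla\alpha\to\alpha$; - R: $\;(\nabla\alpha\to\nabla\beta)\to\nabla(\alpha\to\beta)$; - D: $\;\nabla(\alpha\lor\beta)\to\nabla\alpha\lor\nabla\beta$; - $\forall_\nabla$: $\;\nabla\forall x\,\alpha(x)\leftrightarrow\forall x\,\nabla\alpha(x)$; - $\exists_\Box$: $\;\Box\exists x\,p(x)\leftrightarrow\exists x\,\Box p(x)$; - $\forall_\Box$: $\;\forall x\,\Box p(x)\leftrightarrow\Box\forall x\,p(x)$; - $\exists_\nabla$: $\;\exists x\,\nabla\alpha(x)\leftrightarrow\nabla\exists x\,\alpha(x)$; - PC$^*$ (the PC-rule): $\;\nabla\alpha\,/\,\alpha$. **Theorem.** (a) None of the nine principles is derivable in QHC, and neither is the PC-rule. Among these ten, one implies another if and only if this follows by reflexivity and transitivity from the implications $$K\Rightarrow H,\quad K\Rightarrow\exists_\Box,\quad H\Rightarrow R,\quad H\Rightarrow\forall_\Box,\quad \exists_\Box\Rightarrow\forall_\Box,$$ $$PC\Rightarrow PC^*,\quad PC\Rightarrow R,\quad PC\Rightarrow D,\quad PC\Rightarrow\forall_\nabla,\quad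 PC\Rightarrow\exists_\nabla .$$ (b) The Exclusive Disambiguation Principle (ED) $\;\neg(\alpha\land\beta)\to\big(\nabla(\alpha\lor\beta)\to\nabla\alpha\lor\nabla\beta\big)$ is not derivable in QHC; among the nine principles, exactly D and PC imply it. -/

import Mathlib

namespace QHC

/-! ## Formulas

Individual variables are de Bruijn indices (`all` and `ex` bind index `0`), so formulas that differ
only in the names of bound variables are equal. There are no function symbols: a term is an
individual variable. -/

/-- The two sorts of formulas: classical (c-formulas, propositions) and intuitionistic
(i-formulas, problems). -/
inductive Kind : Type
  | c
  | i
  deriving DecidableEq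

/-- Formulas of QHC of each sort. `var s n k v` is the `k`-th `n`-ary predicate variable of sort `s`
applied to the individual variables `v`: a problem variable if `s = i`, a proper predicate variable
if `s = c`. For `s = c` the constants, connectives and quantifiers are the classical ones, for
`s = i` the intuitionistic ones. `wn` is the operator `?` and `oc` is the operator `!`. -/
inductive Fml : Kind → Type
  | var (s : Kind) (n k : ℕ) (v : Fin n → ℕ) : Fml s
  | top {s : Kind} : Fml s
  | bot {s : Kind} : Fml s
  | and {s : Kind} (A B : Fml s) : Fml s
  | or {s : Kind} (A B : Fml s) : Fml s
  | imp {s : Kind} (A B : Fml s) : Fml s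
  | all {s : Kind} (A : Fml s) : Fml s
  | ex {s : Kind} (A : Fml s) : Fml s
  | wn (A : Fml Kind.i) : Fml Kind.c
  | oc (A : Fml Kind.c) : Fml Kind.i

/-- Negation, `A → ⊥`. -/
def Fml.neg {s : Kind} (A : Fml s) : Fml s := Fml.imp A Fml.bot

/-- Equivalence, `(A → B) ∧ (B → A)`. -/
def Fml.iff {s : Kind} (A B : Fml s) : Fml s := Fml.and (Fml.imp A B) (Fml.imp B A)

/-- The composite operator `□ = ?!` on c-formulas. -/
def Fml.box (A : Fml Kind.c) : Fml Kind.c := Fml.wn (Fml.oc A)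

/-- The composite operator `∇ = !?` on i-formulas. -/
def Fml.nabla (A : Fml Kind.i) : Fml Kind.i := Fml.oc (Fml.wn A)

/-- The lift of a map of individual variables under a binder. -/
def up (ρ : ℕ → ℕ) : ℕ → ℕ
  | 0 => 0
  | j + 1 => ρ j + 1

/-- Simultaneous capture-avoiding replacement of the free individual variables by others. -/
def Fml.rename : {s : Kind} → (ℕ → ℕ) → Fml s → Fml s
  | _, ρ, .var s n k v => .var s n k (fun j => ρ (v j))
  | _, _, .top => .top
  | _, _, .bot => .bot
  | _, ρ, .and A B => .and (A.rename ρ) (B.rename ρ)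
  | _, ρ, .or A B => .or (A.rename ρ) (B.rename ρ)
  | _, ρ, .imp A B => .imp (A.rename ρ) (B.rename ρ)
  | _, ρ, .all A => .all (A.rename (up ρ))
  | _, ρ, .ex A => .ex (A.rename (up ρ))
  | _, ρ, .wn A => .wn (A.rename ρ)
  | _, ρ, .oc A => .oc (A.rename ρ)

/-- A substitution for the predicate variables. For the `k`-th `n`-ary variable of sort `s`
it gives a formula of sort `s`, in which the indices `0, …, n - 1` stand for the `n` arguments, and
the index `n + j` stands for the individual variable `j` (a parameter). -/
abbrev PSubst : Type := (s : Kind) → (n : ℕ) → ℕ → Fml s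

/-- The `k`-th `n`-ary predicate variable of sort `s`, as a value of a substitution. -/
def pvar (s : Kind) (n k : ℕ) : Fml s := Fml.var s n k (fun j => j)

/-- The lift of a substitution under a binder of an individual variable: parameters are shifted. -/
def PSubst.up1 (σ : PSubst) : PSubst :=
  fun s n k => (σ s n k).rename (fun j => if j < n then j else j + 1)

/-- Simultaneous capture-avoiding substitution of formulas for the predicate variables. -/
def Fml.subst : {s : Kind} → PSubst → Fml s → Fml s
  | _, σ, .var s n k v =>
      (σ s n k).rename (fun j => if h : j < n then v ⟨j, h⟩ else j - n)
  | _, _, .top => .top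
  | _, _, .bot => .bot
  | _, σ, .and A B => .and (A.subst σ) (B.subst σ)
  | _, σ, .or A B => .or (A.subst σ) (B.subst σ)
  | _, σ, .imp A B => .imp (A.subst σ) (B.subst σ)
  | _, σ, .all A => .all (A.subst σ.up1)
  | _, σ, .ex A => .ex (A.subst σ.up1)
  | _, σ, .wn A => .wn (A.subst σ)
  | _, σ, .oc A => .oc (A.subst σ)

/-- The substitution that makes room for a new `n`-ary predicate variable of sort `s` with
index `0`. -/
def shiftSubst (s : Kind) (n : ℕ) : PSubst :=
  fun s' n' k => pvar s' n' (if s' = s ∧ n' = n then k + 1 else k)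

/-- The substitution of the formula `A` for the `n`-ary predicate variable of sort `s` with index
`0`; the other `n`-ary variables of sort `s` are shifted down. -/
def instSubst (s : Kind) (n : ℕ) (A : Fml s) : PSubst :=
  fun s' n' k =>
    if h : s = s' ∧ n = n' then
      match k with
      | 0 => h.1 ▸ A
      | k + 1 => pvar s' n' k
    else pvar s' n' k

/-- The lift of a substitution under a binder of an `n`-ary predicate variable of sort `s`. -/
def PSubst.up2 (s : Kind) (n : ℕ) (σ : PSubst) : PSubst :=
  fun s' n' k =>
    if s = s' ∧ n = n' then
      match k with
      | 0 => pvar s' n' 0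
      | k + 1 => (σ s' n' k).subst (shiftSubst s n)
    else (σ s' n' k).subst (shiftSubst s n)

/-! ## The meta-logic -/

/-- Meta-formulas: built from formulas (of either sort) by meta-conjunction, meta-implication and
the universal meta-quantifiers over individual variables (`all1`) and over predicate variables
(`all2 s n`, for `n`-ary variables of sort `s`). The quantifier `all2 s n` binds index `0` among the
`n`-ary variables of sort `s`. -/
inductive MFml : Type
  | fml {s : Kind} (A : Fml s) : MFml
  | and (F G : MFml) : MFml
  | imp (F G : MFml) : MFml
  | all1 (F : MFml) : MFml
  | all2 (s : Kind) (n : ℕ) (F : MFml) : MFml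

/-- Replacement of free individual variables in a meta-formula. -/
def MFml.rename : (ℕ → ℕ) → MFml → MFml
  | ρ, .fml A => .fml (A.rename ρ)
  | ρ, .and F G => .and (F.rename ρ) (G.rename ρ)
  | ρ, .imp F G => .imp (F.rename ρ) (G.rename ρ)
  | ρ, .all1 F => .all1 (F.rename (up ρ))
  | ρ, .all2 s n F => .all2 s n (F.rename ρ)

/-- Substitution of formulas for free predicate variables in a meta-formula. -/
def MFml.subst : PSubst → MFml → MFml
  | σ, .fml A => .fml (A.subst σ)
  | σ, .and F G => .and (F.subst σ) (G.subst σ)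
  | σ, .imp F G => .imp (F.subst σ) (G.subst σ)
  | σ, .all1 F => .all1 (F.subst σ.up1)
  | σ, .all2 s n F => .all2 s n (F.subst (σ.up2 s n))

/-- The map of individual variables that puts `x` for index `0` and shifts the others down. -/
def instVar (x : ℕ) : ℕ → ℕ
  | 0 => x
  | j + 1 => j

/-- Derivability of a meta-formula from a finite list of meta-formulas by the meta-rules of
inference: introduction and elimination rules of natural deduction for the meta-connectives and
the meta-quantifiers. The usual condition that the quantified variable is not free in the
assumptions is expressed by shifting the assumptions. (The `α`-conversion rule is built into
the representation of bound variables.) -/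
inductive Der : List MFml → MFml → Prop
  | hyp {Γ : List MFml} {F : MFml} : F ∈ Γ → Der Γ F
  | andI {Γ : List MFml} {F G : MFml} : Der Γ F → Der Γ G → Der Γ (.and F G)
  | andE₁ {Γ : List MFml} {F G : MFml} : Der Γ (.and F G) → Der Γ F
  | andE₂ {Γ : List MFml} {F G : MFml} : Der Γ (.and F G) → Der Γ G
  | impI {Γ : List MFml} {F G : MFml} : Der (F :: Γ) G → Der Γ (.imp F G)
  | impE {Γ : List MFml} {F G : MFml} : Der Γ (.imp F G) → Der Γ F → Der Γ G
  | all1I {Γ : List MFml} {F : MFml} :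
      Der (Γ.map (MFml.rename Nat.succ)) F → Der Γ (.all1 F)
  | all1E {Γ : List MFml} {F : MFml} (x : ℕ) :
      Der Γ (.all1 F) → Der Γ (F.rename (instVar x))
  | all2I {Γ : List MFml} {s : Kind} {n : ℕ} {F : MFml} :
      Der (Γ.map (MFml.subst (shiftSubst s n))) F → Der Γ (.all2 s n F)
  | all2E {Γ : List MFml} {s : Kind} {n : ℕ} {F : MFml} (A : Fml s) :
      Der Γ (.all2 s n F) → Der Γ (F.subst (instSubst s n A))

/-- The meta-conjunction of a non-empty list of meta-formulas, given as head and tail. -/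
def conj : MFml → List MFml → MFml
  | F, [] => F
  | F, G :: L => .and F (conj G L)

/-! ## The derivation system

A principle `· G` is the meta-formula obtained by meta-quantifying `G` over all its individual
and predicate variables; a rule `F₁, …, Fₘ / G` is the meta-formula "for all predicate variables,
(`F₁` for all individual variables) and … and (`Fₘ` for all individual variables) imply
(`G` for all individual variables)". -/

/-- The nullary predicate variable of sort `s` and index `k`. -/
def at0 (s : Kind) (k : ℕ) : Fml s := Fml.var s 0 k ![]

/-- The unary predicate variable of sort `s` and index `k`, applied to the individual variable
`x`. -/
def at1 (s : Kind) (k x : ℕ) : Fml s := Fml.var s 1 k ![x]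

infixr:35 " ⋏ " => Fml.and
infixr:34 " ⋎ " => Fml.or
infixr:33 " ⇾ " => Fml.imp
infix:32 " ⇌ " => Fml.iff

/-- Modus ponens `α, α → β / β`. -/
def modusPonens (s : Kind) : MFml :=
  .all2 s 0 (.all2 s 0 (.imp (.and (.fml (at0 s 0)) (.fml (at0 s 0 ⇾ at0 s 1)))
    (.fml (at0 s 1))))

/-- The remaining laws and inference rules of intuitionistic predicate logic, for formulas of
sort `s`. -/
def intLaws (s : Kind) : List MFml :=
  let a := at0 s 0
  let b := at0 s 1
  let d := at0 s 2
  [ .all2 s 0 (.all2 s 0 (.fml (a ⇾ b ⇾ a))),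
    .all2 s 0 (.all2 s 0 (.all2 s 0 (.fml ((a ⇾ b ⇾ d) ⇾ (a ⇾ b) ⇾ a ⇾ d)))),
    .all2 s 0 (.all2 s 0 (.fml (a ⋏ b ⇾ a))),
    .all2 s 0 (.all2 s 0 (.fml (a ⋏ b ⇾ b))),
    .all2 s 0 (.all2 s 0 (.fml (a ⇾ b ⇾ a ⋏ b))),
    .all2 s 0 (.all2 s 0 (.fml (a ⇾ a ⋎ b))),
    .all2 s 0 (.all2 s 0 (.fml (b ⇾ a ⋎ b))),
    .all2 s 0 (.all2 s 0 (.all2 s 0 (.fml ((a ⇾ d) ⇾ (b ⇾ d) ⇾ a ⋎ b ⇾ d)))),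
    .all2 s 0 (.fml (.bot ⇾ a)),
    .fml (.top : Fml s),
    -- `∀ x, a(x) → a(y)` and `a(y) → ∃ x, a(x)`
    .all2 s 1 (.all1 (.fml (.all (at1 s 0 0) ⇾ at1 s 0 0))),
    .all2 s 1 (.all1 (.fml (at1 s 0 0 ⇾ .ex (at1 s 0 0)))),
    -- `a → b(x) / a → ∀ x, b(x)` and `b(x) → a / (∃ x, b(x)) → a`
    .all2 s 0 (.all2 s 1 (.imp (.all1 (.fml (a ⇾ at1 s 0 0))) (.fml (a ⇾ .all (at1 s 0 0))))),
    .all2 s 0 (.all2 s 1 (.imp (.all1 (.fml (at1 s 0 0 ⇾ a))) (.fml (.ex (at1 s 0 0) ⇾ a)))) ]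

/-- The law of excluded middle, for c-formulas. -/
def excludedMiddle : MFml :=
  .all2 .c 0 (.fml (at0 .c 0 ⋎ (at0 .c 0).neg))

/-- The laws and inference rules of QHC that involve the operators `?` and `!`. -/
def jointLaws : List MFml :=
  let γ := at0 .i 0
  let δ := at0 .i 1
  let p := at0 .c 0
  let q := at0 .c 1
  [ .all2 .i 0 (.all2 .i 0 (.fml (.wn (γ ⋏ δ) ⇌ .wn γ ⋏ .wn δ))),
    .all2 .i 0 (.all2 .i 0 (.fml (.wn (γ ⋎ δ) ⇌ .wn γ ⋎ .wn δ))),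
    .all2 .i 0 (.all2 .i 0 (.fml (.wn (γ ⇾ δ) ⇾ .wn γ ⇾ .wn δ))),
    .fml (Fml.wn .bot).neg,
    .all2 .i 1 (.fml (.wn (.ex (at1 .i 0 0)) ⇌ .ex (.wn (at1 .i 0 0)))),
    .all2 .i 1 (.fml (.wn (.all (at1 .i 0 0)) ⇾ .all (.wn (at1 .i 0 0)))),
    .all2 .i 0 (.fml (γ ⇾ .oc (.wn γ))),
    .fml (Fml.oc .bot).neg,
    .all2 .c 0 (.fml (.wn (.oc p) ⇾ p)),
    .all2 .c 0 (.imp (.fml (.oc p)) (.fml p)),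
    .all2 .c 0 (.fml (.oc p ⇾ .oc (.wn (.oc p)))),
    .all2 .c 0 (.all2 .c 0 (.fml (.oc (p ⇾ q) ⇾ .oc p ⇾ .oc q))),
    .all2 .c 0 (.imp (.fml p) (.fml (.oc p))) ]

/-- The derivation system of QHC: all laws and inference rules of classical predicate logic QC for
the sort `c`, all those of intuitionistic predicate logic QH for the sort `i`, and the laws and
rules for `?` and `!`. -/
def system : MFml :=
  conj (modusPonens .c)
    (intLaws .c ++ [excludedMiddle] ++ [modusPonens .i] ++ intLaws .i ++ jointLaws)

/-- `F` is derivable in QHC. -/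
def Derivable (F : MFml) : Prop := Der [] (.imp system F)

/-- The rule (or principle) `F` implies the rule (or principle) `G` over QHC. -/
def Implies (F G : MFml) : Prop := Derivable (.imp F G)

/-! ## The principles -/

/-- Names of the nine principles and of the PC-rule. -/
inductive Law : Type
  | H
  | K
  | PC
  | R
  | D
  | allNabla
  | exBox
  | allBox
  | exNabla
  | PCRule

/-- The nine principles and the PC-rule as meta-formulas. -/
def Law.meta : Law → MFml
  | .H => .all2 .i 0 (.fml (.wn (at0 .i 0 ⋎ (at0 .i 0).neg)))
  | .K => .all2 .c 0 (.fml ((Fml.oc (at0 .c 0).neg).neg ⇾ .oc (at0 .c 0)))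
  | .PC => .all2 .i 0 (.fml ((at0 .i 0).nabla ⇾ at0 .i 0))
  | .R => .all2 .i 0 (.all2 .i 0 (.fml
      (((at0 .i 0).nabla ⇾ (at0 .i 1).nabla) ⇾ (at0 .i 0 ⇾ at0 .i 1).nabla)))
  | .D => .all2 .i 0 (.all2 .i 0 (.fml
      ((at0 .i 0 ⋎ at0 .i 1).nabla ⇾ (at0 .i 0).nabla ⋎ (at0 .i 1).nabla)))
  | .allNabla => .all2 .i 1 (.fml
      ((Fml.all (at1 .i 0 0)).nabla ⇌ .all (at1 .i 0 0).nabla))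
  | .exBox => .all2 .c 1 (.fml
      ((Fml.ex (at1 .c 0 0)).box ⇌ .ex (at1 .c 0 0).box))
  | .allBox => .all2 .c 1 (.fml
      (Fml.all (at1 .c 0 0).box ⇌ (Fml.all (at1 .c 0 0)).box))
  | .exNabla => .all2 .i 1 (.fml
      (Fml.ex (at1 .i 0 0).nabla ⇌ (Fml.ex (at1 .i 0 0)).nabla))
  | .PCRule => .all2 .i 0 (.imp (.fml (at0 .i 0).nabla) (.fml (at0 .i 0)))

/-- The Exclusive Disambiguation Principle,
`¬(α ∧ β) → (∇(α ∨ β) → ∇α ∨ ∇β)`. -/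
def edPrinciple : MFml :=
  .all2 .i 0 (.all2 .i 0 (.fml ((at0 .i 0 ⋏ at0 .i 1).neg ⇾
    ((at0 .i 0 ⋎ at0 .i 1).nabla ⇾ (at0 .i 0).nabla ⋎ (at0 .i 1).nabla))))

/-- The arrows of the diagram of implications. -/
inductive Arrow : Law → Law → Prop
  | K_H : Arrow .K .H
  | K_exBox : Arrow .K .exBox
  | H_R : Arrow .H .R
  | H_allBox : Arrow .H .allBox
  | exBox_allBox : Arrow .exBox .allBox
  | PC_PCRule : Arrow .PC .PCRule
  | PC_R : Arrow .PC .R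
  | PC_D : Arrow .PC .D
  | PC_allNabla : Arrow .PC .allNabla
  | PC_exNabla : Arrow .PC .exNabla

end QHC

/-!
The positive part consists of derivations in QHC, carried out in the preorder of provable
implication between formulas of one sort: there `?` is left adjoint to `!`, and the quantifiers
are adjoint to the renaming of individual variables by the successor. The two arrows with an idea
behind them are H ⇒ `∀_□` (`IsTheory.allBox_of_H`), where H makes `?` commute with negation, so
that `∀ = ¬∃¬` carries the law `?∃ ↔ ∃?` over to `∀`, and `∃_□` ⇒ `∀_□`
(`IsTheory.allBox_of_exBox`), where `∃_□` is applied to the classical theorem `∃x (A(x) → ∀y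
A(y))`.

The negative part rests on algebraic models. Problems take values in a frame `H`, propositions in
the power set of a family of primes of `H` whose infimum is `⊥`; `?h` is the set of the primes
that are not above `h`, and `!` is its right adjoint, so `∇` is a nucleus on `H`. Meta-formulas
are interpreted with quantification over all `H`-valued or set-valued predicates on an arbitrary
non-empty domain, and the meta-rules are sound (`Der.sound`, `sat_system`). Each principle then
becomes a condition on the nucleus: PC says that it is the identity, D that it preserves binary
joins, and so on.

Two kinds of frames suffice. In the chain `[0, ∞]` every element but `∞` is prime, and D holds for
any choice of primes: `{0}` satisfies K but not `∀_∇` or the PC-rule, two copies of `0` satisfy H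
but not `∃_□`, all primes satisfy PC but not `∀_□`, `[0, 1)` refutes `∃_∇`, and `{0} ∪ [1, ∞)`
satisfies the PC-rule but not R or `∀_∇`. Over a one-element domain all laws about quantifiers
hold, so the same models also separate these from the propositional laws. The lower sets of a fork
refute D and ED, because `∇` adds the root of the fork to the union of its two branches; with the
leaves as points K holds, and with an additional greatest point the PC-rule holds.
-/

namespace QHC

/-! ### Algebraic models -/

/-- An algebraic model of the propositional part of QHC: a frame `H` of values for i-formulas
together with a family of points of `H`, given by prime elements `pt x` whose infimum is `⊥`.
The c-formulas take values in the power set of the index set `X` of the family. -/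
structure Model where
  /-- The frame of values of i-formulas. -/
  H : Type
  [frame : Order.Frame H]
  /-- The index set of the points. -/
  X : Type
  /-- The prime element that corresponds to a point. -/
  pt : X → H
  prime : ∀ x a b, a ⊓ b ≤ pt x → a ≤ pt x ∨ b ≤ pt x
  ne_top : ∀ x, pt x ≠ ⊤
  dense : ∀ h, (∀ x, h ≤ pt x) → h = ⊥

attribute [instance] Model.frame

namespace Model

variable (M : Model)

/-- The algebra of values of the formulas of sort `s`. -/
def Val : Kind → Type
  | .c => Set M.X
  | .i => M.H

instance : (s : Kind) → Order.Frame (M.Val s)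
  | .c => inferInstanceAs (Order.Frame (Set M.X))
  | .i => M.frame

/-- The interpretation of `?`: the set of the points that lie in the "open set" `h`. -/
def wn : M.Val .i → M.Val .c := fun (h : M.H) => ({x | ¬ h ≤ M.pt x} : Set M.X)

/-- The interpretation of `!`, the right adjoint of `Model.wn`. -/
def oc : M.Val .c → M.Val .i := fun (S : Set M.X) => (⨅ x, ⨅ _ : x ∉ S, M.pt x : M.H)

variable {M}

theorem le_oc_iff {h : M.H} {S : Set M.X} :
    LE.le (α := M.H) h (M.oc S) ↔ ∀ x, x ∉ S → h ≤ M.pt x :=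
  le_iInf₂_iff

theorem gc : GaloisConnection M.wn M.oc := fun _ (S : Set M.X) =>
  Iff.trans (forall_congr' fun _ => not_imp_comm) (le_oc_iff (S := S)).symm

theorem wn_inf (a b : M.Val .i) : M.wn (a ⊓ b) = M.wn a ⊓ M.wn b := by
  refine le_antisymm (le_inf (gc.monotone_l inf_le_left) (gc.monotone_l inf_le_right)) ?_
  exact fun x h h' => (M.prime x a b h').elim h.1 h.2

theorem wn_top : M.wn ⊤ = ⊤ :=
  top_le_iff.1 fun x _ h => M.ne_top x (top_le_iff.1 h)

theorem oc_eq_top_iff {S : M.Val .c} : M.oc S = ⊤ ↔ S = ⊤ := by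
  rw [← top_le_iff, ← gc.le_iff_le, wn_top, top_le_iff]

theorem oc_bot : M.oc ⊥ = ⊥ := M.dense _ fun x => iInf₂_le x (Set.notMem_empty x)

theorem oc_himp_le (S T : M.Val .c) : M.oc (S ⇨ T) ≤ M.oc S ⇨ M.oc T := by
  rw [le_himp_iff, ← gc.u_inf, inf_comm]
  exact gc.monotone_u inf_himp_le

theorem wn_himp_le (a b : M.Val .i) : M.wn (a ⇨ b) ≤ M.wn a ⇨ M.wn b := by
  rw [le_himp_iff, ← wn_inf, inf_comm]
  exact gc.monotone_l inf_himp_le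

end Model

/-! ### Interpretation of formulas and meta-formulas -/

/-- The sequence with first term `d` followed by `e`. -/
def scons {D : Type} (d : D) (e : ℕ → D) : ℕ → D
  | 0 => d
  | j + 1 => e j

/-- Interpretations of all predicate variables over the domain `D`. -/
abbrev Valuation (M : Model) (D : Type) : Type :=
  (s : Kind) → (n : ℕ) → ℕ → (Fin n → D) → M.Val s

variable {M : Model} {D : Type}

/-- The value of a formula, for the interpretation `V` of the predicate variables and the
assignment `e` to the individual variables. -/
def Fml.eval (V : Valuation M D) : {s : Kind} → (ℕ → D) → Fml s → M.Val s
  | _, e, .var s n k v => V s n k (fun j => e (v j))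
  | _, _, .top => ⊤
  | _, _, .bot => ⊥
  | _, e, .and A B => A.eval V e ⊓ B.eval V e
  | _, e, .or A B => A.eval V e ⊔ B.eval V e
  | _, e, .imp A B => A.eval V e ⇨ B.eval V e
  | _, e, .all A => ⨅ d, A.eval V (scons d e)
  | _, e, .ex A => ⨆ d, A.eval V (scons d e)
  | _, e, .wn A => M.wn (A.eval V e)
  | _, e, .oc A => M.oc (A.eval V e)

/-- The interpretation `Q` of the `n`-ary variable of sort `s` with index `0`, the others of that
sort and arity being interpreted by `V` with a shift. -/
def Valuation.cons (s : Kind) (n : ℕ) (Q : (Fin n → D) → M.Val s) (V : Valuation M D) :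
    Valuation M D :=
  fun s' n' k =>
    if h : s = s' ∧ n = n' then
      match k with
      | 0 => fun a => h.1 ▸ Q (fun j => a (Fin.cast h.2 j))
      | k + 1 => V s' n' k
    else V s' n' k

/-- Truth of a meta-formula: a formula is true if its value is `⊤`, and the predicate quantifiers
range over all functions with values in the algebra of the sort. -/
def MFml.Sat : Valuation M D → (ℕ → D) → MFml → Prop
  | V, e, .fml A => A.eval V e = ⊤
  | V, e, .and F G => F.Sat V e ∧ G.Sat V e
  | V, e, .imp F G => F.Sat V e → G.Sat V e
  | V, e, .all1 F => ∀ d, F.Sat V (scons d e)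
  | V, e, .all2 s n F => ∀ Q : (Fin n → D) → M.Val s, F.Sat (V.cons s n Q) e

@[simp] theorem scons_zero (d : D) (e : ℕ → D) : scons d e 0 = d := rfl

@[simp] theorem scons_succ (d : D) (e : ℕ → D) (j : ℕ) : scons d e (j + 1) = e j := rfl

theorem scons_up (d : D) (e : ℕ → D) (ρ : ℕ → ℕ) :
    (fun j => scons d e (up ρ j)) = scons d (fun j => e (ρ j)) := by
  funext j
  cases j <;> rfl

@[simp] theorem Valuation.cons_zero (s : Kind) (n : ℕ) (Q : (Fin n → D) → M.Val s)
    (V : Valuation M D) : V.cons s n Q s n 0 = Q := by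
  simp [Valuation.cons]

@[simp] theorem Valuation.cons_succ (s : Kind) (n : ℕ) (Q : (Fin n → D) → M.Val s)
    (V : Valuation M D) (k : ℕ) : V.cons s n Q s n (k + 1) = V s n k := by
  simp [Valuation.cons]

@[simp] theorem Valuation.cons_one_apply_zero (s : Kind) (Q : (Fin 1 → D) → M.Val s)
    (V : Valuation M D) (k : ℕ) : V.cons s 1 Q s 0 k = V s 0 k := by
  simp [Valuation.cons]

theorem Valuation.cons_of_ne {s s' : Kind} {n n' : ℕ} (h : ¬ (s = s' ∧ n = n'))
    (Q : (Fin n → D) → M.Val s) (V : Valuation M D) (k : ℕ) :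
    V.cons s n Q s' n' k = V s' n' k := by
  simp only [Valuation.cons, dif_neg h]

theorem Fml.eval_rename (V : Valuation M D) {s : Kind} (A : Fml s) :
    ∀ (ρ : ℕ → ℕ) (e : ℕ → D), (A.rename ρ).eval V e = A.eval V (fun j => e (ρ j)) := by
  induction A with
  | wn A ih => exact fun ρ e => congrArg M.wn (ih ρ e)
  | oc A ih => exact fun ρ e => congrArg M.oc (ih ρ e)
  | _ => intro ρ e; simp_all [Fml.rename, Fml.eval, scons_up]

/-- The assignment that begins with the arguments `a` and continues with `e`. -/
def append {n : ℕ} (a : Fin n → D) (e : ℕ → D) : ℕ → D :=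
  fun j => if h : j < n then a ⟨j, h⟩ else e (j - n)

/-- The interpretation of the predicate variables that a substitution induces. -/
def Valuation.comp (V : Valuation M D) (σ : PSubst) (e : ℕ → D) : Valuation M D :=
  fun s n k a => (σ s n k).eval V (append a e)

theorem Valuation.comp_up1 (V : Valuation M D) (σ : PSubst) (d : D) (e : ℕ → D) :
    V.comp σ.up1 (scons d e) = V.comp σ e := by
  funext s n k a
  simp only [Valuation.comp, PSubst.up1, Fml.eval_rename]
  congr 1
  funext j
  by_cases h : j < n
  · simp [append, h]
  · have h' : ¬ j + 1 < n := by omega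
    have h'' : j + 1 - n = (j - n) + 1 := by omega
    simp [append, h, h', h'']

theorem Fml.eval_subst (V : Valuation M D) {s : Kind} (A : Fml s) :
    ∀ (σ : PSubst) (e : ℕ → D), (A.subst σ).eval V e = A.eval (V.comp σ e) e := by
  induction A with
  | var s n k v =>
    intro σ e
    simp only [Fml.subst, Fml.eval, Fml.eval_rename, Valuation.comp]
    congr 1
    funext j
    simp only [append]
    split <;> rfl
  | wn A ih => exact fun σ e => congrArg M.wn (ih σ e)
  | oc A ih => exact fun σ e => congrArg M.oc (ih σ e)
  | _ => intro σ e; simp_all [Fml.subst, Fml.eval, Valuation.comp_up1]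

theorem append_apply {n : ℕ} (a : Fin n → D) (e : ℕ → D) :
    (fun j : Fin n => append a e j) = a := by
  funext j
  simp [append]

theorem Fml.eval_pvar (V : Valuation M D) (s : Kind) (n k : ℕ) (a : Fin n → D) (e : ℕ → D) :
    (pvar s n k).eval V (append a e) = V s n k a := by
  simp only [pvar, Fml.eval, append_apply]

theorem Valuation.comp_shiftSubst (V : Valuation M D) (s : Kind) (n : ℕ)
    (Q : (Fin n → D) → M.Val s) (e : ℕ → D) :
    (V.cons s n Q).comp (shiftSubst s n) e = V := by
  funext s' n' k a
  simp only [Valuation.comp, shiftSubst, Fml.eval_pvar]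
  by_cases h : s' = s ∧ n' = n
  · obtain ⟨rfl, rfl⟩ := h
    simp
  · rw [if_neg h, Valuation.cons_of_ne]
    exact fun h' => h ⟨h'.1.symm, h'.2.symm⟩

theorem Valuation.comp_instSubst (V : Valuation M D) (s : Kind) (n : ℕ) (A : Fml s) (e : ℕ → D) :
    V.comp (instSubst s n A) e = V.cons s n (fun a => A.eval V (append a e)) := by
  funext s' n' k a
  simp only [Valuation.comp, instSubst]
  by_cases h : s = s' ∧ n = n'
  · obtain ⟨rfl, rfl⟩ := h
    cases k <;> simp [Fml.eval_pvar]
  · rw [dif_neg h, Valuation.cons_of_ne h, Fml.eval_pvar]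

theorem Valuation.comp_up2 (V : Valuation M D) (s : Kind) (n : ℕ) (σ : PSubst)
    (Q : (Fin n → D) → M.Val s) (e : ℕ → D) :
    (V.cons s n Q).comp (σ.up2 s n) e = (V.comp σ e).cons s n Q := by
  funext s' n' k a
  simp only [Valuation.comp, PSubst.up2]
  by_cases h : s = s' ∧ n = n'
  · obtain ⟨rfl, rfl⟩ := h
    cases k <;> simp [Fml.eval_pvar, Fml.eval_subst, Valuation.comp_shiftSubst]
    rfl
  · rw [if_neg h, Valuation.cons_of_ne h, Fml.eval_subst, Valuation.comp_shiftSubst]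
    rfl

theorem MFml.sat_rename (F : MFml) : ∀ (V : Valuation M D) (ρ : ℕ → ℕ) (e : ℕ → D),
    (F.rename ρ).Sat V e ↔ F.Sat V (fun j => e (ρ j)) := by
  induction F <;> intro V ρ e <;>
    simp_all [MFml.rename, MFml.Sat, scons_up, Fml.eval_rename]

theorem MFml.sat_subst (F : MFml) : ∀ (V : Valuation M D) (σ : PSubst) (e : ℕ → D),
    (F.subst σ).Sat V e ↔ F.Sat (V.comp σ e) e := by
  induction F <;> intro V σ e <;>
    simp_all [MFml.subst, MFml.Sat, Fml.eval_subst, Valuation.comp_up1, Valuation.comp_up2]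

theorem Der.sound {Γ : List MFml} {F : MFml} (h : Der Γ F) :
    ∀ (V : Valuation M D) (e : ℕ → D), (∀ G ∈ Γ, G.Sat V e) → F.Sat V e := by
  induction h with
  | hyp hF => exact fun V e H => H _ hF
  | andI _ _ ih₁ ih₂ => exact fun V e H => ⟨ih₁ V e H, ih₂ V e H⟩
  | andE₁ _ ih => exact fun V e H => (ih V e H).1
  | andE₂ _ ih => exact fun V e H => (ih V e H).2
  | impI _ ih =>
    exact fun V e H hF => ih V e (List.forall_mem_cons.2 ⟨hF, H⟩)
  | impE _ _ ih₁ ih₂ => exact fun V e H => ih₁ V e H (ih₂ V e H)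
  | all1I _ ih =>
    intro V e H d
    refine ih V _ ?_
    simpa [MFml.sat_rename] using H
  | all1E x _ ih =>
    intro V e H
    rw [MFml.sat_rename]
    convert ih V e H (e x) using 1
    funext j
    cases j <;> rfl
  | all2I _ ih =>
    intro V e H Q
    refine ih _ e ?_
    simpa [MFml.sat_subst, Valuation.comp_shiftSubst] using H
  | all2E A _ ih =>
    intro V e H
    rw [MFml.sat_subst, Valuation.comp_instSubst]
    exact ih V e H _

theorem MFml.sat_conj (V : Valuation M D) (e : ℕ → D) (F : MFml) (L : List MFml) :
    (conj F L).Sat V e ↔ ∀ G ∈ F :: L, G.Sat V e := by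
  induction L generalizing F with
  | nil => simp [conj]
  | cons G L ih => rw [conj, MFml.Sat, ih, List.forall_mem_cons (l := G :: L)]

end QHC

namespace QHC

/-! ### Soundness of the derivation system -/

variable {M : Model} {D : Type}

theorem sat_intLaws [Nonempty D] (V : Valuation M D) (e : ℕ → D) (s : Kind) :
    ∀ G ∈ modusPonens s :: intLaws s, G.Sat V e := by
  simp only [intLaws, modusPonens, List.forall_mem_cons, MFml.Sat, at0, at1, Fml.eval,
    Valuation.cons_zero, Valuation.cons_succ, Valuation.cons_one_apply_zero, himp_eq_top_iff,
    le_himp_iff]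
  have h0 (d : D) : (fun j => scons d e ((![] : Fin 0 → ℕ) j)) = fun j => e (![] j) :=
    Subsingleton.elim _ _
  have h1 (d d' : D) : (fun j => scons d' (scons d e) ((![0] : Fin 1 → ℕ) j)) =
      fun j => scons d' e (![0] j) := by
    funext j; simp
  refine ⟨?_, ?_, ?_, ?_, ?_, ?_, ?_, ?_, ?_, ?_, ?_, ?_, ?_, ?_, ?_, by simp⟩
  · exact fun _ _ h => top_le_iff.1 (h.1 ▸ h.2)
  · exact fun _ _ => inf_le_left
  · intro P Q R
    generalize (R fun j => e (![] j)) = a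
    generalize (Q fun j => e (![] j)) = b
    generalize (P fun j => e (![] j)) = c
    have h₁ : (a ⇨ b ⇨ c) ⊓ (a ⇨ b) ⊓ a ≤ b ⇨ c :=
      (inf_le_inf_right a inf_le_left).trans himp_inf_le
    have h₂ : (a ⇨ b ⇨ c) ⊓ (a ⇨ b) ⊓ a ≤ b :=
      (inf_le_inf_right a inf_le_right).trans himp_inf_le
    exact (le_inf h₁ h₂).trans himp_inf_le
  · exact fun _ _ => inf_le_left
  · exact fun _ _ => inf_le_right
  · exact fun _ _ => le_rfl
  · exact fun _ _ => le_sup_left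
  · exact fun _ _ => le_sup_right
  · intro P Q R
    rw [inf_sup_left]
    exact sup_le ((inf_le_inf_right _ inf_le_left).trans himp_inf_le)
      ((inf_le_inf_right _ inf_le_right).trans himp_inf_le)
  · exact fun _ => bot_le
  · trivial
  · intro Q d
    simp only [h1]
    exact iInf_le (fun d => Q fun j => scons d e (![0] j)) d
  · intro Q d
    simp only [h1]
    exact le_iSup (fun d => Q fun j => scons d e (![0] j)) d
  · intro P Q h
    exact le_iInf fun d => h0 d ▸ h d
  · intro P Q h
    exact iSup_le fun d => h0 d ▸ h d

theorem sat_excludedMiddle (V : Valuation M D) (e : ℕ → D) : excludedMiddle.Sat V e := by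
  simp only [excludedMiddle, MFml.Sat, at0, Fml.eval, Valuation.cons_zero, Fml.neg]
  exact fun Q => sup_compl_eq_top (α := Set M.X)

theorem sat_jointLaws (V : Valuation M D) (e : ℕ → D)  :
    ∀ G ∈ jointLaws, G.Sat V e := by
  simp only [jointLaws, List.forall_mem_cons, MFml.Sat, at0, at1, Fml.eval, Valuation.cons_zero,
    Valuation.cons_succ, himp_eq_top_iff, Fml.iff, Fml.neg, inf_eq_top_iff]
  have gc := Model.gc (M := M)
  refine ⟨fun _ _ => ⟨?_, ?_⟩, fun _ _ => ⟨?_, ?_⟩, fun _ _ => ?_, ?_, fun _ => ⟨?_, ?_⟩,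
    fun _ => ?_, fun _ => ?_, ?_, fun _ => ?_, fun _ h => ?_, fun _ => ?_, fun _ _ => ?_,
    fun _ h => ?_, by simp⟩
  · exact (Model.wn_inf _ _).le
  · exact (Model.wn_inf _ _).ge
  · exact gc.l_sup.le
  · exact gc.l_sup.ge
  · exact Model.wn_himp_le _ _
  · exact gc.l_bot.le
  · exact gc.l_iSup.le
  · exact gc.l_iSup.ge
  · exact gc.monotone_l.map_iInf_le
  · exact gc.le_u_l _
  · exact Model.oc_bot.le
  · exact gc.l_u_le _
  · exact Model.oc_eq_top_iff.1 h
  · exact gc.le_u_l _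
  · exact Model.oc_himp_le _ _
  · exact Model.oc_eq_top_iff.2 h

theorem sat_system [Nonempty D] (V : Valuation M D) (e : ℕ → D) : system.Sat V e := by
  rw [system, MFml.sat_conj]
  simp only [List.forall_mem_cons, List.forall_mem_append, List.append_assoc]
  have hc := List.forall_mem_cons.1 (sat_intLaws V e .c)
  have hi := List.forall_mem_cons.1 (sat_intLaws V e .i)
  exact ⟨hc.1, hc.2, ⟨sat_excludedMiddle V e, by simp⟩, ⟨hi.1, by simp⟩, hi.2, sat_jointLaws V e⟩

/-- Truth of a meta-formula in the model `M` with the domain `D`, for all interpretations. -/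
def Model.Valid (M : Model) (D : Type) (F : MFml) : Prop :=
  ∀ (V : Valuation M D) (e : ℕ → D), F.Sat V e

theorem Implies.valid [Nonempty D] {F G : MFml} (h : Implies F G) (hF : M.Valid D F) :
    M.Valid D G :=
  fun V e => Der.sound h V e (by simp) (sat_system V e) (hF V e)

theorem Derivable.valid [Nonempty D] {F : MFml} (h : Derivable F) : M.Valid D F :=
  fun V e => Der.sound h V e (by simp) (sat_system V e)

/-! ### The principles in a model -/

namespace Model

theorem valid_all2_zero [Nonempty D] {s : Kind} {F : MFml} {P : M.Val s → Prop}
    (h : ∀ (V : Valuation M D) (e : ℕ → D) Q, F.Sat (V.cons s 0 Q) e ↔ P (Q fun j => e (![] j))) :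
    M.Valid D (.all2 s 0 F) ↔ ∀ a, P a :=
  ⟨fun H a => (h _ _ _).1 (H (fun _ _ _ _ => ⊤) (fun _ => Classical.arbitrary D) fun _ => a),
    fun H V e Q => (h V e Q).2 (H _)⟩

theorem valid_all2_zero_zero [Nonempty D] {s : Kind} {F : MFml} {P : M.Val s → M.Val s → Prop}
    (h : ∀ (V : Valuation M D) (e : ℕ → D) Q Q', F.Sat ((V.cons s 0 Q).cons s 0 Q') e ↔
      P (Q fun j => e (![] j)) (Q' fun j => e (![] j))) :
    M.Valid D (.all2 s 0 (.all2 s 0 F)) ↔ ∀ a b, P a b :=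
  ⟨fun H a b => (h _ _ _ _).1
      (H (fun _ _ _ _ => ⊤) (fun _ => Classical.arbitrary D) (fun _ => a) fun _ => b),
    fun H V e Q Q' => (h V e Q Q').2 (H _ _)⟩

theorem valid_all2_one [Nonempty D] {s : Kind} {F : MFml} {P : (D → M.Val s) → Prop}
    (h : ∀ (V : Valuation M D) (e : ℕ → D) Q, F.Sat (V.cons s 1 Q) e ↔
      P (fun d => Q fun j => scons d e (![0] j))) :
    M.Valid D (.all2 s 1 F) ↔ ∀ a, P a :=
  ⟨fun H a => by
      simpa using (h _ _ _).1
        (H (fun _ _ _ _ => ⊤) (fun _ => Classical.arbitrary D) fun v => a (v 0)),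
    fun H V e Q => (h V e Q).2 (H _)⟩

/-- The nucleus `∇` on the frame of values of i-formulas. -/
def nab (M : Model) (a : M.Val .i) : M.Val .i := M.oc (M.wn a)

/-- The interior operator `□` on the algebra of values of c-formulas. -/
def box (M : Model) (S : M.Val .c) : M.Val .c := M.wn (M.oc S)

theorem nab_mono : Monotone M.nab := gc.monotone_u.comp gc.monotone_l

variable (M D) [Nonempty D]

theorem valid_H : M.Valid D Law.H.meta ↔ ∀ a, M.wn (a ⊔ (a ⇨ ⊥)) = ⊤ :=
  valid_all2_zero fun V e Q => by
    simp only [MFml.Sat, at0, Fml.eval, Valuation.cons_zero, Fml.neg]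

theorem valid_K : M.Valid D Law.K.meta ↔ ∀ S, M.oc (S ⇨ ⊥) ⇨ ⊥ ≤ M.oc S :=
  valid_all2_zero fun V e Q => by
    simp only [MFml.Sat, at0, Fml.eval, Valuation.cons_zero, Fml.neg, himp_eq_top_iff]

theorem valid_PC : M.Valid D Law.PC.meta ↔ ∀ a, M.nab a ≤ a :=
  valid_all2_zero fun V e Q => by
    simp only [MFml.Sat, at0, Fml.eval, Valuation.cons_zero, Fml.nabla, himp_eq_top_iff, nab]

theorem valid_R : M.Valid D Law.R.meta ↔ ∀ a b, M.nab a ⇨ M.nab b ≤ M.nab (a ⇨ b) := by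
  rw [forall_comm]
  exact valid_all2_zero_zero fun V e Q Q' => by
    simp only [MFml.Sat, at0, Fml.eval, Valuation.cons_zero, Valuation.cons_succ, Fml.nabla,
      himp_eq_top_iff, nab]

theorem valid_D : M.Valid D Law.D.meta ↔ ∀ a b, M.nab (a ⊔ b) ≤ M.nab a ⊔ M.nab b := by
  rw [forall_comm]
  exact valid_all2_zero_zero fun V e Q Q' => by
    simp only [MFml.Sat, at0, Fml.eval, Valuation.cons_zero, Valuation.cons_succ, Fml.nabla,
      himp_eq_top_iff, nab]

theorem valid_edPrinciple : M.Valid D edPrinciple ↔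
    ∀ a b, a ⊓ b ⇨ ⊥ ≤ M.nab (a ⊔ b) ⇨ M.nab a ⊔ M.nab b := by
  rw [forall_comm]
  exact valid_all2_zero_zero fun V e Q Q' => by
    simp only [MFml.Sat, at0, Fml.eval, Valuation.cons_zero, Valuation.cons_succ, Fml.nabla,
      Fml.neg, himp_eq_top_iff, nab]

theorem valid_PCRule : M.Valid D Law.PCRule.meta ↔ ∀ a, M.nab a = ⊤ → a = ⊤ :=
  valid_all2_zero fun V e Q => by
    simp only [MFml.Sat, at0, Fml.eval, Valuation.cons_zero, Fml.nabla, nab]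

theorem valid_allNabla : M.Valid D Law.allNabla.meta ↔
    ∀ a : D → M.Val .i, ⨅ d, M.nab (a d) ≤ M.nab (⨅ d, a d) :=
  valid_all2_one fun V e Q => by
    simp only [MFml.Sat, at1, Fml.eval, Valuation.cons_zero, Fml.nabla, Fml.iff, inf_eq_top_iff,
      himp_eq_top_iff]
    exact and_iff_right nab_mono.map_iInf_le

theorem valid_exNabla : M.Valid D Law.exNabla.meta ↔
    ∀ a : D → M.Val .i, M.nab (⨆ d, a d) ≤ ⨆ d, M.nab (a d) :=
  valid_all2_one fun V e Q => by
    simp only [MFml.Sat, at1, Fml.eval, Valuation.cons_zero, Fml.nabla, Fml.iff, inf_eq_top_iff,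
      himp_eq_top_iff]
    exact and_iff_right nab_mono.le_map_iSup

theorem valid_exBox : M.Valid D Law.exBox.meta ↔
    ∀ a : D → M.Val .c, M.box (⨆ d, a d) ≤ ⨆ d, M.box (a d) :=
  valid_all2_one fun V e Q => by
    simp only [MFml.Sat, at1, Fml.eval, Valuation.cons_zero, Fml.box, Fml.iff, inf_eq_top_iff,
      himp_eq_top_iff]
    exact and_iff_left (gc.monotone_l.comp gc.monotone_u).le_map_iSup

theorem valid_allBox : M.Valid D Law.allBox.meta ↔
    ∀ a : D → M.Val .c, ⨅ d, M.box (a d) ≤ M.box (⨅ d, a d) :=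
  valid_all2_one fun V e Q => by
    simp only [MFml.Sat, at1, Fml.eval, Valuation.cons_zero, Fml.box, Fml.iff, inf_eq_top_iff,
      himp_eq_top_iff]
    exact and_iff_left (gc.monotone_l.comp gc.monotone_u).map_iInf_le

end Model

end QHC

namespace QHC

open scoped ENNReal

/-! ### The nucleus in terms of points -/

namespace Model

theorem le_nab_iff {M : Model} {a b : M.H} :
    LE.le (α := M.H) b (M.nab a) ↔ ∀ x, a ≤ M.pt x → b ≤ M.pt x :=
  le_oc_iff.trans (forall_congr' fun _ => by
    change (¬ ¬ (a ≤ _) → _) ↔ _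
    rw [not_not])

theorem nab_le_pt {M : Model} {a : M.H} {x : M.X} (h : a ≤ M.pt x) :
    LE.le (α := M.H) (M.nab a) (M.pt x) :=
  le_nab_iff.1 (le_refl (α := M.H) _) x h

theorem nab_bot {M : Model} : M.nab ⊥ = ⊥ :=
  M.dense _ fun _ => nab_le_pt (bot_le (α := M.H))

theorem pt_ne_nab_top {M : Model} {a : M.H} {x : M.X} (h : a ≤ M.pt x) : M.nab a ≠ ⊤ := fun h' =>
  M.ne_top x (top_le_iff.1 (h' ▸ nab_le_pt h))

/-! ### One-element domains -/

theorem valid_allNabla_unit (M : Model) : M.Valid Unit Law.allNabla.meta :=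
  (valid_allNabla M Unit).2 fun _ => by simp only [iInf_unique, le_refl]

theorem valid_exNabla_unit (M : Model) : M.Valid Unit Law.exNabla.meta :=
  (valid_exNabla M Unit).2 fun _ => by simp only [iSup_unique, le_refl]

theorem valid_exBox_unit (M : Model) : M.Valid Unit Law.exBox.meta :=
  (valid_exBox M Unit).2 fun _ => by simp only [iSup_unique, le_refl]

/-! ### Models on a chain -/

/-- The model on the chain `[0, ∞]` with the given family of points, one of which has to be `0`
and none of which may be `∞`. In a chain all elements are prime. -/
noncomputable def chain {X : Type} (pt : X → ℝ≥0∞) (hpt : ∀ x, pt x ≠ ∞) (h0 : ∃ x, pt x = 0) :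
    Model where
  H := ℝ≥0∞
  X := X
  pt := pt
  prime _ _ _ h := inf_le_iff.1 h
  ne_top := hpt
  dense _ h := le_bot_iff.1 (h0.elim fun x hx => (h x).trans_eq hx)

variable {X : Type} {pt : X → ℝ≥0∞} {hpt : ∀ x, pt x ≠ ∞} {h0 : ∃ x, pt x = 0}

theorem le_nab_chain_iff {a b : ℝ≥0∞} :
    LE.le (α := ℝ≥0∞) b ((chain pt hpt h0).nab a) ↔ ∀ x, a ≤ pt x → b ≤ pt x :=
  le_nab_iff (M := chain pt hpt h0)

theorem le_oc_chain_iff {b : ℝ≥0∞} {S : Set X} :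
    LE.le (α := ℝ≥0∞) b ((chain pt hpt h0).oc S) ↔ ∀ x, x ∉ S → b ≤ pt x :=
  le_oc_iff (M := chain pt hpt h0)

theorem nab_chain_le {a : ℝ≥0∞} {x : X} (h : a ≤ pt x) :
    LE.le (α := ℝ≥0∞) ((chain pt hpt h0).nab a) (pt x) :=
  le_nab_chain_iff.1 le_rfl x h

theorem nab_chain_ne_top {a : ℝ≥0∞} {x : X} (h : a ≤ pt x) :
    (chain pt hpt h0).nab a ≠ ⊤ :=
  pt_ne_nab_top (M := chain pt hpt h0) h

theorem valid_D_chain (D : Type) [Nonempty D] : (chain pt hpt h0).Valid D Law.D.meta := by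
  rw [valid_D]
  intro a b
  have h : a ≤ b ∨ b ≤ a := le_total (α := ℝ≥0∞) a b
  rcases h with h | h
  · rw [sup_eq_right.2 h]
    exact le_sup_right
  · rw [sup_eq_left.2 h]
    exact le_sup_left

/-- The positive elements of `[0, ∞]`, as a domain of individuals. -/
abbrev PosDom : Type := Set.Ioi (0 : ℝ≥0∞)

instance : Nonempty PosDom := ⟨⟨1, zero_lt_one (α := ℝ≥0∞)⟩⟩

theorem iInf_posDom_eq : ⨅ d : PosDom, (d : ℝ≥0∞) = 0 := by
  refine le_bot_iff.1 (le_of_forall_gt_imp_ge_of_dense fun d hd => ?_)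
  exact iInf_le (fun d : PosDom => (d : ℝ≥0∞)) ⟨d, hd⟩

/-- If no point lies in `(0, 1)`, then `∇d ≥ 1` for all `d > 0`, but the infimum of these `d` is `0`
and `∇0 = 0`. -/
theorem not_valid_allNabla_chain (h : ∀ x, pt x = 0 ∨ 1 ≤ pt x) :
    ¬ (chain pt hpt h0).Valid PosDom Law.allNabla.meta := by
  intro H
  have H := (valid_allNabla _ _).1 H fun d => (d : ℝ≥0∞)
  have e : (⨅ d : PosDom, (d : ℝ≥0∞) : (chain pt hpt h0).Val .i) = ⊥ := iInf_posDom_eq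
  rw [e, nab_bot] at H
  have h1 : (1 : ℝ≥0∞) ≤ 0 := by
    refine le_trans ?_ H
    refine le_iInf (α := ℝ≥0∞) fun d => ?_
    refine le_nab_chain_iff.2 fun x hx => ?_
    rcases h x with h | h
    · exact absurd (hx.trans_eq h) (not_le.2 d.2)
    · exact h
  simp at h1

/-- The chain all of whose points are equal to `0`. Here `∇a = ∞` for all `a ≠ 0`. -/
noncomputable abbrev const (X : Type) [Nonempty X] : Model :=
  chain (X := X) (fun _ => 0) (fun _ => ENNReal.zero_ne_top) ⟨Classical.arbitrary X, rfl⟩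

theorem wn_const [Nonempty X] {a : (const X).Val .i} (h : a ≠ ⊥) : (const X).wn a = ⊤ :=
  top_le_iff.1 fun _ _ h' => h (le_bot_iff.1 h')

theorem valid_K_const :
    (const Unit).Valid Unit Law.K.meta ∧ (const Unit).Valid PosDom Law.K.meta := by
  rw [valid_K, valid_K, and_self]
  intro S
  by_cases h : (() : Unit) ∈ (show Set Unit from S)
  · have hS : S = ⊤ := Set.eq_univ_of_forall fun x => h
    rw [hS, oc_eq_top_iff.2 rfl]
    exact le_top
  · have hS : S = ⊥ := Set.eq_empty_of_forall_notMem fun x => h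
    rw [hS, bot_himp, oc_eq_top_iff.2 rfl, top_himp]
    exact bot_le

theorem valid_exNabla_const [Nonempty X] (D : Type) [Nonempty D] :
    (const X).Valid D Law.exNabla.meta := by
  rw [valid_exNabla]
  intro a
  by_cases h : ∀ d, a d = ⊥
  · simp only [h, iSup_bot, nab_bot, le_refl]
  · obtain ⟨d, hd⟩ := not_forall.1 h
    refine le_trans le_top (le_trans ?_ (le_iSup _ d))
    exact (oc_eq_top_iff.2 (wn_const hd)).ge

theorem valid_H_const [Nonempty X] (D : Type) [Nonempty D] :
    (const X).Valid D Law.H.meta := by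
  rw [valid_H]
  intro a
  by_cases h : a = ⊥
  · rw [h, bot_himp, sup_top_eq, wn_top]
  · exact top_le_iff.1 (wn_const h ▸ gc.monotone_l le_sup_left)

theorem not_valid_PCRule_const [Nonempty X] (D : Type) [Nonempty D] :
    ¬ (const X).Valid D Law.PCRule.meta := by
  rw [valid_PCRule]
  intro H
  refine ENNReal.one_ne_top (H (1 : ℝ≥0∞) (oc_eq_top_iff.2 (wn_const ?_)))
  exact one_ne_zero (α := ℝ≥0∞)

/-- The whole set `{true, false}` is open, but its two singletons have empty interior. -/
theorem not_valid_exBox_const : ¬ (const Bool).Valid Bool Law.exBox.meta := by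
  rw [valid_exBox]
  intro H
  have H := H fun d => ({d} : Set Bool)
  have e : (⨆ d, ({d} : Set Bool) : (const Bool).Val .c) = ⊤ := Set.iUnion_of_singleton Bool
  have h1 : (const Bool).box ⊤ = ⊤ := by
    rw [box, oc_eq_top_iff.2 rfl, wn_top]
  have h2 (d : Bool) : (const Bool).box ({d} : Set Bool) = ⊥ := by
    refine le_bot_iff.1 fun x hx => hx ?_
    exact le_oc_chain_iff.1 le_rfl (!d) (Bool.not_ne_self d)
  rw [e, h1] at H
  simp only [h2, iSup_bot] at H
  exact H (Set.mem_univ true)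

/-- The points are the elements below `1`: these are closed under `∇`, but their supremum `1` is
not, as `∇1 = ∞`. -/
theorem exists_not_valid_exNabla : ∃ (M : Model) (D : Type), Nonempty D ∧
    M.Valid D Law.D.meta ∧ ¬ M.Valid D Law.exNabla.meta := by
  have ne : Nonempty (Set.Iio (1 : ℝ≥0∞)) := ⟨⟨0, zero_lt_one (α := ℝ≥0∞)⟩⟩
  refine ⟨chain (X := Set.Iio (1 : ℝ≥0∞)) Subtype.val (fun x => (x.2.trans ENNReal.one_lt_top).ne)
    ⟨⟨0, zero_lt_one (α := ℝ≥0∞)⟩, rfl⟩, Set.Iio (1 : ℝ≥0∞), ne, valid_D_chain _, ?_⟩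
  rw [valid_exNabla]
  intro H
  have H := H fun d => (d : ℝ≥0∞)
  have h1 : (1 : ℝ≥0∞) ≤ ⨆ d : Set.Iio (1 : ℝ≥0∞), (d : ℝ≥0∞) := by
    refine le_of_forall_lt_imp_le_of_dense fun d hd => ?_
    exact le_iSup (fun d : Set.Iio (1 : ℝ≥0∞) => (d : ℝ≥0∞)) ⟨d, hd⟩
  have h2 : (∞ : ℝ≥0∞) ≤ 1 := by
    refine le_trans ?_ (H.trans (iSup_le (α := ℝ≥0∞) (a := 1) fun d => ?_))
    · exact le_nab_chain_iff.2 fun x hx => absurd x.2 (not_lt.2 (h1.trans hx))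
    · exact le_trans (nab_chain_le (x := d) le_rfl) (le_of_lt d.2)
  simp at h2

/-- The points are all the elements other than `∞`, so every element is closed under `∇`. -/
theorem exists_not_valid_allBox : ∃ (M : Model) (D : Type), Nonempty D ∧
    M.Valid D Law.PC.meta ∧ ¬ M.Valid D Law.allBox.meta := by
  refine ⟨chain (X := Set.Iio (∞ : ℝ≥0∞)) Subtype.val (fun x => ne_of_lt x.2)
    ⟨(⟨0, ENNReal.zero_lt_top⟩ : Set.Iio (∞ : ℝ≥0∞)), rfl⟩, PosDom, inferInstance, ?_, ?_⟩
  · rw [valid_PC]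
    intro (a : ℝ≥0∞)
    by_cases h : a = ∞
    · rw [h]
      exact le_top
    · exact nab_chain_le (pt := Subtype.val)
        (x := (⟨a, lt_top_iff_ne_top.2 h⟩ : Set.Iio (∞ : ℝ≥0∞))) le_rfl
  · rw [valid_allBox]
    intro H
    -- the intervals `[0, d)` are open, but their intersection `{0}` has empty interior
    have H := H fun d => {x : Set.Iio (∞ : ℝ≥0∞) | (x : ℝ≥0∞) < d}
    have H := @H (⟨0, ENNReal.zero_lt_top⟩ : Set.Iio (∞ : ℝ≥0∞)) (Set.mem_iInter.2 fun d h => ?_)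
    · refine H (show LE.le (α := ℝ≥0∞) _ 0 from le_of_forall_gt_imp_ge_of_dense fun d hd => ?_)
      by_cases h : d = ∞
      · exact le_top.trans_eq h.symm
      · refine le_oc_chain_iff.1 le_rfl
          (⟨d, lt_top_iff_ne_top.2 h⟩ : Set.Iio (∞ : ℝ≥0∞)) fun hx => ?_
        exact lt_irrefl d (Set.mem_iInter.1 hx ⟨d, hd⟩)
    · refine not_le.2 d.2 (le_trans (α := ℝ≥0∞) ?_ h)
      exact le_oc_chain_iff.2 fun x hx => not_lt.1 hx

/-- The chain whose points are `0` and the elements of `[1, ∞)`. Here `∇` maps `(0, 1]` to `1` and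
fixes all other elements. -/
noncomputable abbrev gap : Model :=
  chain (X := {x : ℝ≥0∞ // x ≠ ∞ ∧ (x = 0 ∨ 1 ≤ x)}) Subtype.val (fun x => x.2.1)
    ⟨⟨0, ENNReal.zero_ne_top, Or.inl rfl⟩, rfl⟩

theorem valid_PCRule_gap (D : Type) [Nonempty D] : gap.Valid D Law.PCRule.meta := by
  rw [valid_PCRule]
  intro (a : ℝ≥0∞) ha
  by_contra h
  exact nab_chain_ne_top (a := a) (pt := Subtype.val)
    (x := ⟨max a 1, (max_lt (lt_top_iff_ne_top.2 h) ENNReal.one_lt_top).ne,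
      Or.inr (le_max_right _ _)⟩) (le_max_left _ _) ha

/-- In `gap` one has `∇(1/2) = 1 = ∇1`, but `1 → 1/2` is `1/2`. -/
theorem not_valid_R_gap (D : Type) [Nonempty D] : ¬ gap.Valid D Law.R.meta := by
  rw [valid_R]
  intro H
  have h2 : ¬ (1 : ℝ≥0∞) ≤ 2⁻¹ := by simp
  have h1 : gap.nab (1 : ℝ≥0∞) ≤ gap.nab (2⁻¹ : ℝ≥0∞) := by
    refine le_nab_chain_iff.2 fun x hx => nab_chain_le ?_
    rcases x.2.2 with h | h
    · have : (2⁻¹ : ℝ≥0∞) ≤ 0 := hx.trans_eq h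
      simp at this
    · exact h
  have H := H (1 : ℝ≥0∞) (2⁻¹ : ℝ≥0∞)
  rw [himp_eq_top_iff.2 h1, top_le_iff] at H
  refine nab_chain_ne_top (x := ⟨1, ENNReal.one_ne_top, Or.inr le_rfl⟩) ?_ H
  have h3 : ((1 : ℝ≥0∞) ⇨ 2⁻¹) ⊓ 1 ≤ 2⁻¹ := himp_inf_le
  refine le_trans ((inf_le_iff.1 h3).resolve_right h2) ?_
  change (2⁻¹ : ℝ≥0∞) ≤ 1
  simp

end Model

end QHC

namespace QHC

namespace Model

/-! ### Kripke models -/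

/-- The model on the lower sets of a preorder whose points are the elements of a set `S` that is
coinitial in the preorder. -/
def kripke {P : Type} [Preorder P] (S : Set P) (hS : ∀ y, ∃ x ∈ S, x ≤ y) : Model where
  H := LowerSet P
  X := S
  pt x := ⟨{y | ¬ (x : P) ≤ y}, fun _ _ h h' h'' => h' (h''.trans h)⟩
  prime x a b h := by
    by_contra! H
    obtain ⟨⟨y, hy, hy'⟩, ⟨z, hz, hz'⟩⟩ := And.imp Set.not_subset.1 Set.not_subset.1 H
    exact h ⟨a.lower (not_not.1 hy') hy, b.lower (not_not.1 hz') hz⟩ le_rfl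
  ne_top x h := by
    have : (x : P) ∈ (⊤ : LowerSet P) := trivial
    exact (h ▸ this) le_rfl
  dense h H := by
    refine le_bot_iff.1 fun y hy => ?_
    obtain ⟨x, hx, hxy⟩ := hS y
    exact H ⟨x, hx⟩ hy hxy

variable {P : Type} [Preorder P] {S : Set P} {hS : ∀ y, ∃ x ∈ S, x ≤ y}

theorem le_pt_kripke {a : LowerSet P} {x : S} : a ≤ (kripke S hS).pt x ↔ (x : P) ∉ a :=
  ⟨fun h hx => h hx le_rfl, fun h _ hy hxy => h (a.lower hxy hy)⟩

theorem mem_nab_kripke {a : LowerSet P} {y : P} :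
    Membership.mem (γ := LowerSet P) ((kripke S hS).nab a) y ↔ ∀ x ∈ S, x ≤ y → x ∈ a := by
  refine (LowerSet.Iic_le (s := ((kripke S hS).nab a : LowerSet P))).symm.trans ?_
  refine (le_nab_iff (M := kripke S hS)).trans ⟨fun h x hx hxy => ?_, fun h (x : S) hx => ?_⟩
  · by_contra hxa
    exact le_pt_kripke.1 (h ⟨x, hx⟩ (le_pt_kripke.2 hxa)) hxy
  · exact le_pt_kripke.2 fun hxy => le_pt_kripke.1 hx (h x x.2 hxy)

theorem valid_allNabla_kripke (D : Type) [Nonempty D] :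
    (kripke S hS).Valid D Law.allNabla.meta := by
  rw [valid_allNabla]
  intro a y hy
  refine mem_nab_kripke.2 fun x hx hxy => ?_
  refine LowerSet.mem_iInf_iff.2 fun d => ?_
  exact mem_nab_kripke.1 (LowerSet.mem_iInf_iff.1 hy d) x hx hxy

/-- The fork `left, right < root` with an additional greatest element `apex`. -/
inductive Fork : Type
  | left
  | right
  | root
  | apex

/-- The height of an element of the fork. -/
def Fork.height : Fork → ℕ
  | left => 0
  | right => 0
  | root => 1
  | apex => 2

instance : Preorder Fork where
  le x y := x = y ∨ x.height < y.height
  le_refl _ := Or.inl rfl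
  le_trans x y z := by
    rintro (rfl | h) (rfl | h')
    exacts [Or.inl rfl, Or.inr h', Or.inr h, Or.inr (h.trans h')]

theorem Fork.le_def {x y : Fork} : x ≤ y ↔ x = y ∨ x.height < y.height := Iff.rfl

section Fork

variable {S : Set Fork} {hS : ∀ y, ∃ x ∈ S, x ≤ y}

/-- If the root is not a point, then `∇` adds it to the union of the two branches. -/
theorem root_mem_nab_sup (h : Fork.root ∉ S) :
    Membership.mem (γ := LowerSet Fork)
      ((kripke S hS).nab (LowerSet.Iic Fork.left ⊔ LowerSet.Iic Fork.right : LowerSet Fork))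
      Fork.root := by
  refine mem_nab_kripke.2 fun x hx hxy => ?_
  cases x
  · exact Or.inl (le_refl Fork.left)
  · exact Or.inr (le_refl Fork.right)
  · exact absurd hx h
  · simp [Fork.le_def, Fork.height] at hxy

theorem root_notMem_nab_left (h : Fork.right ∈ S) :
    ¬ Membership.mem (γ := LowerSet Fork) ((kripke S hS).nab (LowerSet.Iic Fork.left))
      Fork.root := fun H => by
  have := mem_nab_kripke.1 H .right h (by simp [Fork.le_def, Fork.height])
  simp [Fork.le_def, Fork.height] at this

theorem root_notMem_nab_right (h : Fork.left ∈ S) :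
    ¬ Membership.mem (γ := LowerSet Fork) ((kripke S hS).nab (LowerSet.Iic Fork.right))
      Fork.root := fun H => by
  have := mem_nab_kripke.1 H .left h (by simp [Fork.le_def, Fork.height])
  simp [Fork.le_def, Fork.height] at this

variable (hl : Fork.left ∈ S) (hr : Fork.right ∈ S) (h : Fork.root ∉ S)
include hl hr h

theorem not_valid_edPrinciple_fork (D : Type) [Nonempty D] :
    ¬ (kripke S hS).Valid D edPrinciple := by
  rw [valid_edPrinciple]
  intro H
  have H := H (LowerSet.Iic .left : LowerSet Fork) (LowerSet.Iic .right : LowerSet Fork)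
  rw [himp_eq_top_iff.2, top_le_iff, himp_eq_top_iff] at H
  · exact (H (root_mem_nab_sup h)).elim (root_notMem_nab_left hr) (root_notMem_nab_right hl)
  · rintro y ⟨hy, hy'⟩
    cases y <;> simp [Fork.le_def, Fork.height] at hy hy'

theorem not_valid_D_fork (D : Type) [Nonempty D] : ¬ (kripke S hS).Valid D Law.D.meta := by
  rw [valid_D]
  exact fun H => (H _ _ (root_mem_nab_sup h)).elim (root_notMem_nab_left hr)
    (root_notMem_nab_right hl)

theorem not_valid_exNabla_fork : ¬ (kripke S hS).Valid Bool Law.exNabla.meta := by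
  rw [valid_exNabla]
  intro H
  have H := H fun d => LowerSet.Iic (bif d then Fork.left else Fork.right)
  have e := iSup_bool_eq (α := LowerSet Fork)
    (f := fun d => LowerSet.Iic (bif d then Fork.left else Fork.right))
  have H' := H (e ▸ root_mem_nab_sup (hS := hS) h)
  obtain ⟨d, hd⟩ := LowerSet.mem_iSup_iff.1 H'
  cases d
  exacts [root_notMem_nab_right hl hd, root_notMem_nab_left hr hd]

end Fork

/-- The fork with the two minimal elements as points. -/
abbrev leaves : Model :=
  kripke {Fork.left, Fork.right} fun y => by cases y <;> simp [Fork.le_def, Fork.height]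

/-- The fork with all elements but `root` as points. -/
abbrev rootless : Model :=
  kripke {Fork.root}ᶜ fun y => by
    cases y
    · exact ⟨.left, by simp, le_rfl⟩
    · exact ⟨.right, by simp, le_rfl⟩
    · exact ⟨.left, by simp, Or.inr (by simp [Fork.height])⟩
    · exact ⟨.apex, by simp, le_rfl⟩

theorem valid_PCRule_rootless (D : Type) [Nonempty D] : rootless.Valid D Law.PCRule.meta := by
  rw [valid_PCRule]
  intro (a : LowerSet Fork) ha
  have h : Membership.mem (γ := LowerSet Fork) (rootless.nab a) Fork.apex := by
    rw [ha]
    trivial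
  have h := mem_nab_kripke.1 h .apex (by simp) le_rfl
  refine top_le_iff.1 fun y _ => a.lower ?_ h
  cases y <;> simp [Fork.le_def, Fork.height]

/-- The points of `leaves` are pairwise incomparable, so a point outside of `T` lies in `!¬T` and
hence not in `¬!¬T`. -/
theorem valid_K_leaves (D : Type) [Nonempty D] : leaves.Valid D Law.K.meta := by
  rw [valid_K]
  intro (T : Set ({Fork.left, Fork.right} : Set Fork))
  refine (le_oc_iff (M := leaves)).2 fun (x : ({Fork.left, Fork.right} : Set Fork)) hx =>
    le_pt_kripke.2 fun h => ?_
  have h' : Membership.mem (γ := LowerSet Fork) (leaves.oc (Tᶜ : Set _)) x.1 := by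
    refine LowerSet.Iic_le.1 ?_
    refine (le_oc_iff (M := leaves)).2 fun (y : ({Fork.left, Fork.right} : Set Fork)) hy =>
      le_pt_kripke.2 fun hyx => ?_
    have : y ≠ x := fun e => hx (e ▸ not_not.1 hy)
    obtain ⟨x, rfl | rfl⟩ := x <;> obtain ⟨y, rfl | rfl⟩ := y <;>
      simp_all [Fork.le_def, Fork.height]
  have e : leaves.oc (T ⇨ ⊥ : Set _) = leaves.oc (Tᶜ : Set _) :=
    congrArg leaves.oc (himp_bot (α := Set _) T)
  exact (himp_inf_le (a := leaves.oc (T ⇨ ⊥ : Set _)) (b := ⊥)) ⟨h, e ▸ h'⟩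

end Model

end QHC

namespace QHC

/-! ### Substitution into closed meta-formulas -/

theorem up_eq {ρ : ℕ → ℕ} (h : ∀ j, ρ j = j) (j : ℕ) : up ρ j = j := by
  cases j
  · rfl
  · exact congrArg (· + 1) (h _)

theorem Fml.rename_eq {s : Kind} (A : Fml s) : ∀ {ρ : ℕ → ℕ}, (∀ j, ρ j = j) → A.rename ρ = A := by
  induction A <;> intro ρ h <;> simp_all [Fml.rename, up_eq]

theorem Fml.rename_rename {s : Kind} (A : Fml s) :
    ∀ ρ τ : ℕ → ℕ, (A.rename ρ).rename τ = A.rename (fun j => τ (ρ j)) := by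
  have h (ρ τ : ℕ → ℕ) : (fun j => up τ (up ρ j)) = up fun j => τ (ρ j) := by
    funext j
    cases j <;> rfl
  induction A <;> intro ρ τ <;> simp_all [Fml.rename]

@[simp] theorem pvar_zero (s : Kind) (k : ℕ) : pvar s 0 k = at0 s k :=
  congrArg (Fml.var s 0 k) (Subsingleton.elim _ _)

@[simp] theorem pvar_one (s : Kind) (k : ℕ) : pvar s 1 k = at1 s k 0 :=
  congrArg (Fml.var s 1 k) (by funext j; simp)

@[simp] theorem rename_at0 (s : Kind) (k : ℕ) (ρ : ℕ → ℕ) : (at0 s k).rename ρ = at0 s k :=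
  congrArg (Fml.var s 0 k) (Subsingleton.elim _ _)

@[simp] theorem rename_at1 (s : Kind) (k x : ℕ) (ρ : ℕ → ℕ) :
    (at1 s k x).rename ρ = at1 s k (ρ x) :=
  congrArg (Fml.var s 1 k) (by funext j; simp)

@[simp] theorem subst_at0 (s : Kind) (k : ℕ) (σ : PSubst) : (at0 s k).subst σ = σ s 0 k :=
  Fml.rename_eq _ fun _ => rfl

@[simp] theorem subst_at1 (s : Kind) (k x : ℕ) (σ : PSubst) :
    (at1 s k x).subst σ = (σ s 1 k).rename (instVar x) := by
  simp only [at1, Fml.subst]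
  congr 1
  funext j
  cases j <;> simp [instVar]

theorem pvar_rename_up1 (s : Kind) (n k : ℕ) :
    (pvar s n k).rename (fun j => if j < n then j else j + 1) = pvar s n k := by
  simp [pvar, Fml.rename]

@[simp] theorem PSubst.up2_zero (s : Kind) (n : ℕ) (σ : PSubst) : σ.up2 s n s n 0 = pvar s n 0 := by
  simp [PSubst.up2]

@[simp] theorem PSubst.up2_succ (s : Kind) (n k : ℕ) (σ : PSubst) :
    σ.up2 s n s n (k + 1) = (σ s n k).subst (shiftSubst s n) := by
  simp [PSubst.up2]

@[simp] theorem PSubst.up2_one_apply_zero (s : Kind) (k : ℕ) (σ : PSubst) :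
    σ.up2 s 1 s 0 k = (σ s 0 k).subst (shiftSubst s 1) := by
  simp [PSubst.up2]

@[simp] theorem shiftSubst_self (s : Kind) (n k : ℕ) : shiftSubst s n s n k = pvar s n (k + 1) := by
  simp [shiftSubst]

@[simp] theorem shiftSubst_one_apply_zero (s : Kind) (k : ℕ) : shiftSubst s 1 s 0 k = at0 s k := by
  simp [shiftSubst]

@[simp] theorem instSubst_zero (s : Kind) (n : ℕ) (A : Fml s) : instSubst s n A s n 0 = A := by
  simp [instSubst]

@[simp] theorem instSubst_succ (s : Kind) (n k : ℕ) (A : Fml s) :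
    instSubst s n A s n (k + 1) = pvar s n k := by
  simp [instSubst]

@[simp] theorem up1_shiftSubst (s : Kind) (n : ℕ) : (shiftSubst s n).up1 = shiftSubst s n := by
  funext s' n' k
  simp only [PSubst.up1, shiftSubst, pvar_rename_up1]

@[simp] theorem up1_instSubst (s : Kind) (n : ℕ) (A : Fml s) : (instSubst s n A).up1 =
    instSubst s n (A.rename fun j => if j < n then j else j + 1) := by
  funext s' n' k
  by_cases h : s = s' ∧ n = n'
  · obtain ⟨rfl, rfl⟩ := h
    cases k <;> simp [PSubst.up1, pvar_rename_up1]
  · simp only [PSubst.up1, instSubst, dif_neg h, pvar_rename_up1]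

theorem Fml.subst_shiftSubst_var (s s' : Kind) (n n' k : ℕ) (v : Fin n' → ℕ) :
    (Fml.var s' n' k v).subst (shiftSubst s n) =
      .var s' n' (if s' = s ∧ n' = n then k + 1 else k) v := by
  simp [Fml.subst, shiftSubst, pvar, Fml.rename]

theorem Fml.subst_shiftSubst_rename (s : Kind) (n : ℕ) {s' : Kind} (A : Fml s') : ∀ ρ : ℕ → ℕ,
    (A.rename ρ).subst (shiftSubst s n) = (A.subst (shiftSubst s n)).rename ρ := by
  induction A with
  | var => intro ρ; simp only [Fml.rename, Fml.subst_shiftSubst_var]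
  | _ => intro ρ; simp_all [Fml.rename, Fml.subst]

theorem up1_up2 (s : Kind) (n : ℕ) (σ : PSubst) : (σ.up2 s n).up1 = σ.up1.up2 s n := by
  funext s' n' k
  by_cases h : s = s' ∧ n = n'
  · obtain ⟨rfl, rfl⟩ := h
    cases k <;> simp [PSubst.up1, pvar_rename_up1, Fml.subst_shiftSubst_rename]
  · simp only [PSubst.up1, PSubst.up2, if_neg h, Fml.subst_shiftSubst_rename]

theorem Fml.subst_shiftSubst_up2 (s : Kind) (n : ℕ) {s' : Kind} (A : Fml s') : ∀ σ : PSubst,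
    (A.subst (shiftSubst s n)).subst (σ.up2 s n) = (A.subst σ).subst (shiftSubst s n) := by
  induction A with
  | var s' n' k v =>
    intro σ
    rw [Fml.subst_shiftSubst_var, Fml.subst, Fml.subst, Fml.subst_shiftSubst_rename]
    by_cases h : s = s' ∧ n = n'
    · obtain ⟨rfl, rfl⟩ := h
      simp
    · rw [if_neg fun h' => h ⟨h'.1.symm, h'.2.symm⟩]
      simp only [PSubst.up2, if_neg h]
  | _ => intro σ; simp_all [Fml.subst, up1_up2]

/-- When the outer one of two predicate quantifiers is instantiated, the substituted formula is
shifted under the inner one. Instantiating the latter undoes the shift. -/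
@[simp] theorem Fml.subst_shiftSubst_instSubst (s : Kind) (n : ℕ) {s' : Kind} (A : Fml s') :
    ∀ B : Fml s, (A.subst (shiftSubst s n)).subst (instSubst s n B) = A := by
  induction A with
  | var s' n' k v =>
    intro B
    rw [Fml.subst_shiftSubst_var, Fml.subst]
    have e : (pvar s' n' k).rename (fun j => if h : j < n' then v ⟨j, h⟩ else j - n') =
        .var s' n' k v := by
      simp [pvar, Fml.rename]
    by_cases h : s = s' ∧ n = n'
    · obtain ⟨rfl, rfl⟩ := h
      simpa using e
    · rw [if_neg fun h' => h ⟨h'.1.symm, h'.2.symm⟩]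
      simpa only [instSubst, dif_neg h] using e
  | _ => intro B; simp_all [Fml.subst]

/-- A meta-formula without free variables of any kind, in the sense that renaming and substitution
leave it unchanged. -/
structure MFml.Closed (F : MFml) : Prop where
  rename : ∀ ρ, F.rename ρ = F
  subst : ∀ σ, F.subst σ = F

@[simp] theorem up_zero (ρ : ℕ → ℕ) : up ρ 0 = 0 := rfl

theorem closed_conj {F : MFml} {L : List MFml} (h : ∀ G ∈ F :: L, G.Closed) :
    (conj F L).Closed := by
  induction L generalizing F with
  | nil => exact h F (by simp)
  | cons G L ih =>
    have hF := h F (by simp)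
    have hG := ih fun G hG => h G (List.mem_cons_of_mem _ hG)
    exact ⟨fun ρ => by rw [conj, MFml.rename, hF.rename, hG.rename],
      fun σ => by rw [conj, MFml.subst, hF.subst, hG.subst]⟩

theorem closed_intLaws (s : Kind) : ∀ G ∈ modusPonens s :: intLaws s, G.Closed := by
  simp only [intLaws, modusPonens, List.forall_mem_cons]
  refine ⟨?_, ?_, ?_, ?_, ?_, ?_, ?_, ?_, ?_, ?_, ?_, ?_, ?_, ?_, ?_, by simp⟩
  all_goals
    constructor <;> intro <;>
      simp [MFml.rename, MFml.subst, Fml.rename, Fml.subst, PSubst.up1, instVar]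

theorem closed_jointLaws : ∀ G ∈ jointLaws, G.Closed := by
  simp only [jointLaws, List.forall_mem_cons]
  refine ⟨?_, ?_, ?_, ?_, ?_, ?_, ?_, ?_, ?_, ?_, ?_, ?_, ?_, by simp⟩
  all_goals
    constructor <;> intro <;>
      simp [MFml.rename, MFml.subst, Fml.rename, Fml.subst, Fml.iff, Fml.neg, PSubst.up1, instVar]

theorem closed_excludedMiddle : excludedMiddle.Closed := by
  constructor <;> intro <;>
    simp [excludedMiddle, MFml.rename, MFml.subst, Fml.rename, Fml.subst, Fml.neg]

theorem closed_system : system.Closed := by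
  refine closed_conj ?_
  simp only [List.forall_mem_cons, List.forall_mem_append, List.append_assoc]
  have hc := List.forall_mem_cons.1 (closed_intLaws .c)
  have hi := List.forall_mem_cons.1 (closed_intLaws .i)
  exact ⟨hc.1, hc.2, ⟨closed_excludedMiddle, by simp⟩, ⟨hi.1, by simp⟩, hi.2, closed_jointLaws⟩

theorem Law.closed_meta (P : Law) : P.meta.Closed := by
  cases P <;> constructor <;> intro <;>
    simp [Law.meta, MFml.rename, MFml.subst, Fml.rename, Fml.subst, Fml.iff, Fml.neg, Fml.nabla,
      Fml.box, PSubst.up1, instVar]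

end QHC

namespace QHC

/-! ### The order of provable implication -/

theorem Der.of_conj {Γ : List MFml} {F G : MFml} {L : List MFml} (h : Der Γ (conj F L))
    (hG : G ∈ F :: L) : Der Γ G := by
  induction L generalizing F with
  | nil => exact List.mem_singleton.1 hG ▸ h
  | cons K L ih =>
    rcases List.mem_cons.1 hG with rfl | hG
    · exact h.andE₁
    · exact ih h.andE₂ hG

/-- A list of assumptions from which the derivation system of QHC follows and in which no
individual variable is free. -/
structure IsTheory (Γ : List MFml) : Prop where
  system : Der Γ system
  closed : Γ.map (MFml.rename Nat.succ) = Γ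

/-- The preorder of provable implication. -/
abbrev Le (Γ : List MFml) {s : Kind} (A B : Fml s) : Prop := Der Γ (.fml (A ⇾ B))

namespace IsTheory

variable {Γ : List MFml} (h : IsTheory Γ)
include h

theorem of_mem_intLaws {s : Kind} {G : MFml} (hG : G ∈ modusPonens s :: intLaws s) : Der Γ G := by
  refine h.system.of_conj ?_
  rw [List.mem_cons] at hG
  simp only [List.mem_cons, List.mem_append]
  cases s <;> tauto

theorem of_mem_jointLaws {G : MFml} (hG : G ∈ jointLaws) : Der Γ G :=
  h.system.of_conj (by simp only [List.mem_cons, List.mem_append]; tauto)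

theorem excludedMiddle : Der Γ excludedMiddle :=
  h.system.of_conj (by simp only [List.mem_cons, List.mem_append]; tauto)

variable {s : Kind}

theorem mp {A B : Fml s} (hAB : Le Γ A B) (hA : Der Γ (.fml A)) : Der Γ (.fml B) := by
  have H := ((h.of_mem_intLaws (s := s) (G := modusPonens s) (by simp)).all2E B).all2E A
  simp only [MFml.subst, Fml.subst, subst_at0, PSubst.up2_zero, PSubst.up2_succ, instSubst_zero,
    pvar_zero, Fml.subst_shiftSubst_instSubst] at H
  exact H.impE (hA.andI hAB)

theorem imp_const (A B : Fml s) : Le Γ A (B ⇾ A) := by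
  have H := ((h.of_mem_intLaws (s := s)
    (G := .all2 s 0 (.all2 s 0 (.fml (at0 s 0 ⇾ at0 s 1 ⇾ at0 s 0)))) (by simp [intLaws])).all2E
    B).all2E A
  simpa [MFml.subst, Fml.subst] using H

theorem imp_distrib (A B C : Fml s) : Le Γ (A ⇾ B ⇾ C) ((A ⇾ B) ⇾ A ⇾ C) := by
  have H := (((h.of_mem_intLaws (s := s) (G := .all2 s 0 (.all2 s 0 (.all2 s 0
    (.fml ((at0 s 0 ⇾ at0 s 1 ⇾ at0 s 2) ⇾ (at0 s 0 ⇾ at0 s 1) ⇾ at0 s 0 ⇾ at0 s 2)))))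
    (by simp [intLaws])).all2E C).all2E B).all2E A
  simpa [MFml.subst, Fml.subst, Fml.subst_shiftSubst_up2] using H

theorem and_le_left (A B : Fml s) : Le Γ (A ⋏ B) A := by
  have H := ((h.of_mem_intLaws (s := s)
    (G := .all2 s 0 (.all2 s 0 (.fml (at0 s 0 ⋏ at0 s 1 ⇾ at0 s 0)))) (by simp [intLaws])).all2E
    B).all2E A
  simpa [MFml.subst, Fml.subst] using H

theorem and_le_right (A B : Fml s) : Le Γ (A ⋏ B) B := by
  have H := ((h.of_mem_intLaws (s := s)
    (G := .all2 s 0 (.all2 s 0 (.fml (at0 s 0 ⋏ at0 s 1 ⇾ at0 s 1)))) (by simp [intLaws])).all2E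
    B).all2E A
  simpa [MFml.subst, Fml.subst] using H

theorem le_imp_and (A B : Fml s) : Le Γ A (B ⇾ A ⋏ B) := by
  have H := ((h.of_mem_intLaws (s := s)
    (G := .all2 s 0 (.all2 s 0 (.fml (at0 s 0 ⇾ at0 s 1 ⇾ at0 s 0 ⋏ at0 s 1))))
    (by simp [intLaws])).all2E B).all2E A
  simpa [MFml.subst, Fml.subst] using H

theorem le_or_left (A B : Fml s) : Le Γ A (A ⋎ B) := by
  have H := ((h.of_mem_intLaws (s := s)
    (G := .all2 s 0 (.all2 s 0 (.fml (at0 s 0 ⇾ at0 s 0 ⋎ at0 s 1)))) (by simp [intLaws])).all2E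
    B).all2E A
  simpa [MFml.subst, Fml.subst] using H

theorem le_or_right (A B : Fml s) : Le Γ B (A ⋎ B) := by
  have H := ((h.of_mem_intLaws (s := s)
    (G := .all2 s 0 (.all2 s 0 (.fml (at0 s 1 ⇾ at0 s 0 ⋎ at0 s 1)))) (by simp [intLaws])).all2E
    B).all2E A
  simpa [MFml.subst, Fml.subst] using H

theorem or_elim (A B C : Fml s) : Le Γ (A ⇾ C) ((B ⇾ C) ⇾ A ⋎ B ⇾ C) := by
  have H := (((h.of_mem_intLaws (s := s) (G := .all2 s 0 (.all2 s 0 (.all2 s 0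
    (.fml ((at0 s 0 ⇾ at0 s 2) ⇾ (at0 s 1 ⇾ at0 s 2) ⇾ at0 s 0 ⋎ at0 s 1 ⇾ at0 s 2)))))
    (by simp [intLaws])).all2E C).all2E B).all2E A
  simpa [MFml.subst, Fml.subst, Fml.subst_shiftSubst_up2] using H

theorem bot_le (A : Fml s) : Le Γ .bot A := by
  have H := (h.of_mem_intLaws (s := s) (G := .all2 s 0 (.fml (.bot ⇾ at0 s 0)))
    (by simp [intLaws])).all2E A
  simpa [MFml.subst, Fml.subst] using H

theorem all_le (A : Fml s) (x : ℕ) : Le Γ (.all A) (A.rename (instVar x)) := by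
  have H := ((h.of_mem_intLaws (s := s)
    (G := .all2 s 1 (.all1 (.fml (.all (at1 s 0 0) ⇾ at1 s 0 0)))) (by simp [intLaws])).all2E
    A).all1E x
  simp only [MFml.subst, MFml.rename, Fml.subst, Fml.rename, Fml.rename_rename, subst_at1,
    up1_instSubst, instSubst_zero] at H
  refine (congrArg₂ (fun B C => Der Γ (.fml (.imp (.all B) C))) ?_ ?_).mp H
  · exact Fml.rename_eq _ fun j => by rcases j with _ | j <;> simp [instVar, up]
  · exact congrArg (fun ρ => A.rename ρ) (funext fun j => by rcases j with _ | j <;> simp [instVar])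

theorem le_ex (A : Fml s) (x : ℕ) : Le Γ (A.rename (instVar x)) (.ex A) := by
  have H := ((h.of_mem_intLaws (s := s)
    (G := .all2 s 1 (.all1 (.fml (at1 s 0 0 ⇾ .ex (at1 s 0 0))))) (by simp [intLaws])).all2E
    A).all1E x
  simp only [MFml.subst, MFml.rename, Fml.subst, Fml.rename, Fml.rename_rename, subst_at1,
    up1_instSubst, instSubst_zero] at H
  refine (congrArg₂ (fun B C => Der Γ (.fml (.imp C (.ex B)))) ?_ ?_).mp H
  · exact Fml.rename_eq _ fun j => by rcases j with _ | j <;> simp [instVar, up]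
  · exact congrArg (fun ρ => A.rename ρ) (funext fun j => by rcases j with _ | j <;> simp [instVar])

theorem le_all {A B : Fml s} (H : Le Γ (A.rename Nat.succ) B) : Le Γ A (.all B) := by
  have K := ((h.of_mem_intLaws (s := s) (G := .all2 s 0 (.all2 s 1 (.imp
    (.all1 (.fml (at0 s 0 ⇾ at1 s 0 0))) (.fml (at0 s 0 ⇾ .all (at1 s 0 0))))))
    (by simp [intLaws])).all2E A).all2E B
  have e : B.rename (fun j => instVar (instVar 0 0) (if j = 0 then j else j + 1)) = B :=
    Fml.rename_eq _ fun j => by rcases j with _ | j <;> simp [instVar]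
  simp [MFml.subst, Fml.subst, Fml.rename_rename, up1_up2] at K
  rw [e] at K
  exact K.impE (Der.all1I (h.closed.symm ▸ H))

theorem ex_le {A B : Fml s} (H : Le Γ B (A.rename Nat.succ)) : Le Γ (.ex B) A := by
  have K := ((h.of_mem_intLaws (s := s) (G := .all2 s 0 (.all2 s 1 (.imp
    (.all1 (.fml (at1 s 0 0 ⇾ at0 s 0))) (.fml (.ex (at1 s 0 0) ⇾ at0 s 0)))))
    (by simp [intLaws])).all2E A).all2E B
  have e : B.rename (fun j => instVar (instVar 0 0) (if j = 0 then j else j + 1)) = B :=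
    Fml.rename_eq _ fun j => by rcases j with _ | j <;> simp [instVar]
  simp [MFml.subst, Fml.subst, Fml.rename_rename, up1_up2] at K
  rw [e] at K
  exact K.impE (Der.all1I (h.closed.symm ▸ H))

theorem rename_all_le (A : Fml s) : Le Γ ((Fml.all A).rename Nat.succ) A := by
  have e : (A.rename (up Nat.succ)).rename (instVar 0) = A := by
    rw [Fml.rename_rename]
    exact Fml.rename_eq _ fun j => by rcases j with _ | j <;> rfl
  have H := h.all_le (A.rename (up Nat.succ)) 0
  rwa [e] at H

theorem le_rename_ex (A : Fml s) : Le Γ A ((Fml.ex A).rename Nat.succ) := by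
  have e : (A.rename (up Nat.succ)).rename (instVar 0) = A := by
    rw [Fml.rename_rename]
    exact Fml.rename_eq _ fun j => by rcases j with _ | j <;> rfl
  have H := h.le_ex (A.rename (up Nat.succ)) 0
  rwa [e] at H

theorem of_true (A : Fml s) {B : Fml s} (hB : Der Γ (.fml B)) : Le Γ A B :=
  h.mp (h.imp_const B A) hB

theorem trans {A B C : Fml s} (h₁ : Le Γ A B) (h₂ : Le Γ B C) : Le Γ A C :=
  h.mp (h.mp (h.imp_distrib A B C) (h.of_true A h₂)) h₁

theorem refl (A : Fml s) : Le Γ A A :=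
  h.mp (h.mp (h.imp_distrib A (A ⇾ A) A) (h.imp_const A (A ⇾ A))) (h.imp_const A A)

theorem le_and {A B C : Fml s} (h₁ : Le Γ A B) (h₂ : Le Γ A C) : Le Γ A (B ⋏ C) :=
  h.mp (h.mp (h.imp_distrib A C (B ⋏ C)) (h.trans h₁ (h.le_imp_and B C))) h₂

theorem or_le {A B C : Fml s} (h₁ : Le Γ A C) (h₂ : Le Γ B C) : Le Γ (A ⋎ B) C :=
  h.mp (h.mp (h.or_elim A B C) h₁) h₂

theorem le_imp {A B C : Fml s} (H : Le Γ (A ⋏ B) C) : Le Γ A (B ⇾ C) :=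
  h.trans (h.le_imp_and A B) (h.mp (h.imp_distrib B (A ⋏ B) C) (h.of_true B H))

theorem and_le {A B C : Fml s} (H : Le Γ A (B ⇾ C)) : Le Γ (A ⋏ B) C :=
  h.mp (h.mp (h.imp_distrib (A ⋏ B) B C) (h.trans (h.and_le_left A B) H)) (h.and_le_right A B)

theorem imp_of_le {A B C D : Fml s} (h₁ : Le Γ C A) (h₂ : Le Γ B D) : Le Γ (A ⇾ B) (C ⇾ D) :=
  h.le_imp (h.trans (h.le_and (h.and_le_left _ _) (h.trans (h.and_le_right _ _) h₁))
    (h.trans (h.and_le (h.refl _)) h₂))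

/-- Distributivity, in the form of a proof by cases under an assumption. -/
theorem and_or_le {A B C D : Fml s} (h₁ : Le Γ (A ⋏ B) D) (h₂ : Le Γ (A ⋏ C) D) :
    Le Γ (A ⋏ (B ⋎ C)) D := by
  have key {B : Fml s} (H : Le Γ (A ⋏ B) D) : Le Γ B (A ⇾ D) :=
    h.le_imp (h.trans (h.le_and (h.and_le_right _ _) (h.and_le_left _ _)) H)
  exact h.trans (h.le_and (h.and_le_right _ _) (h.and_le_left _ _))
    (h.and_le (h.or_le (key h₁) (key h₂)))

theorem le_of_cases {A B C D : Fml s} (H : Der Γ (.fml (B ⋎ C))) (h₁ : Le Γ (A ⋏ B) D)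
    (h₂ : Le Γ (A ⋏ C) D) : Le Γ A D :=
  h.trans (h.le_and (h.refl A) (h.of_true A H)) (h.and_or_le h₁ h₂)

theorem and_neg_le (A B : Fml s) : Le Γ (A ⋏ A.neg) B :=
  h.trans (h.trans (h.le_and (h.and_le_right _ _) (h.and_le_left _ _)) (h.and_le (h.refl A.neg)))
    (h.bot_le B)

theorem iff_of_le {A B : Fml s} (h₁ : Le Γ A B) (h₂ : Le Γ B A) : Der Γ (.fml (A ⇌ B)) :=
  h.mp (h.mp (h.le_imp_and _ _) h₁) h₂

theorem le_of_iff {A B : Fml s} (H : Der Γ (.fml (A ⇌ B))) : Le Γ A B :=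
  h.mp (h.and_le_left _ _) H

theorem ge_of_iff {A B : Fml s} (H : Der Γ (.fml (A ⇌ B))) : Le Γ B A :=
  h.mp (h.and_le_right _ _) H

theorem em (A : Fml .c) : Der Γ (.fml (A ⋎ A.neg)) := by
  simpa [MFml.subst, Fml.subst, Fml.neg] using h.excludedMiddle.all2E A

/-! ### The operators `?` and `!` as an adjunction -/

theorem le_nabla (A : Fml .i) : Le Γ A A.nabla := by
  have H := (h.of_mem_jointLaws (G := .all2 .i 0 (.fml (at0 .i 0 ⇾ .oc (.wn (at0 .i 0)))))
    (by simp [jointLaws])).all2E A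
  simpa [MFml.subst, Fml.subst, Fml.nabla] using H

theorem box_le (A : Fml .c) : Le Γ A.box A := by
  have H := (h.of_mem_jointLaws (G := .all2 .c 0 (.fml (.wn (.oc (at0 .c 0)) ⇾ at0 .c 0)))
    (by simp [jointLaws])).all2E A
  simpa [MFml.subst, Fml.subst, Fml.box] using H

theorem of_oc {A : Fml .c} (hA : Der Γ (.fml (.oc A))) : Der Γ (.fml A) := by
  have H := (h.of_mem_jointLaws (G := .all2 .c 0 (.imp (.fml (.oc (at0 .c 0))) (.fml (at0 .c 0))))
    (by simp [jointLaws])).all2E A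
  simp [MFml.subst, Fml.subst] at H
  exact H.impE hA

theorem oc_of {A : Fml .c} (hA : Der Γ (.fml A)) : Der Γ (.fml (.oc A)) := by
  have H := (h.of_mem_jointLaws (G := .all2 .c 0 (.imp (.fml (at0 .c 0)) (.fml (.oc (at0 .c 0)))))
    (by simp [jointLaws])).all2E A
  simp [MFml.subst, Fml.subst] at H
  exact H.impE hA

theorem wn_of {A : Fml .i} (hA : Der Γ (.fml A)) : Der Γ (.fml (.wn A)) :=
  h.of_oc (h.mp (h.le_nabla A) hA)

theorem wn_imp_le (A B : Fml .i) : Le Γ (.wn (A ⇾ B)) (.wn A ⇾ .wn B) := by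
  have H := ((h.of_mem_jointLaws (G := .all2 .i 0 (.all2 .i 0
    (.fml (.wn (at0 .i 0 ⇾ at0 .i 1) ⇾ .wn (at0 .i 0) ⇾ .wn (at0 .i 1)))))
    (by simp [jointLaws])).all2E B).all2E A
  simpa [MFml.subst, Fml.subst] using H

theorem oc_imp_le (A B : Fml .c) : Le Γ (.oc (A ⇾ B)) (.oc A ⇾ .oc B) := by
  have H := ((h.of_mem_jointLaws (G := .all2 .c 0 (.all2 .c 0
    (.fml (.oc (at0 .c 0 ⇾ at0 .c 1) ⇾ .oc (at0 .c 0) ⇾ .oc (at0 .c 1)))))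
    (by simp [jointLaws])).all2E B).all2E A
  simpa [MFml.subst, Fml.subst] using H

theorem wn_mono {A B : Fml .i} (H : Le Γ A B) : Le Γ (.wn A) (.wn B) :=
  h.mp (h.wn_imp_le A B) (h.wn_of H)

theorem oc_mono {A B : Fml .c} (H : Le Γ A B) : Le Γ (.oc A) (.oc B) :=
  h.mp (h.oc_imp_le A B) (h.oc_of H)

theorem le_oc {A : Fml .i} {B : Fml .c} (H : Le Γ (.wn A) B) : Le Γ A (.oc B) :=
  h.trans (h.le_nabla A) (h.oc_mono H)

theorem box_mono {A B : Fml .c} (H : Le Γ A B) : Le Γ A.box B.box := h.wn_mono (h.oc_mono H)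

theorem nabla_mono {A B : Fml .i} (H : Le Γ A B) : Le Γ A.nabla B.nabla := h.oc_mono (h.wn_mono H)

theorem wn_nabla_le (A : Fml .i) : Le Γ (.wn A.nabla) (.wn A) := h.box_le _

theorem wn_or_le (A B : Fml .i) : Le Γ (.wn (A ⋎ B)) (.wn A ⋎ .wn B) := by
  have H := ((h.of_mem_jointLaws (G := .all2 .i 0 (.all2 .i 0
    (.fml (.wn (at0 .i 0 ⋎ at0 .i 1) ⇌ .wn (at0 .i 0) ⋎ .wn (at0 .i 1)))))
    (by simp [jointLaws])).all2E B).all2E A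
  simp [MFml.subst, Fml.subst, Fml.iff] at H
  exact h.le_of_iff H

theorem wn_and_le (A B : Fml .i) : Le Γ (.wn A ⋏ .wn B) (.wn (A ⋏ B)) := by
  have H := ((h.of_mem_jointLaws (G := .all2 .i 0 (.all2 .i 0
    (.fml (.wn (at0 .i 0 ⋏ at0 .i 1) ⇌ .wn (at0 .i 0) ⋏ .wn (at0 .i 1)))))
    (by simp [jointLaws])).all2E B).all2E A
  simp [MFml.subst, Fml.subst, Fml.iff] at H
  exact h.ge_of_iff H

theorem wn_bot_le : Le Γ (.wn .bot) .bot :=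
  h.of_mem_jointLaws (G := .fml (Fml.wn .bot).neg) (by simp [jointLaws])

theorem oc_bot_le : Le Γ (.oc .bot) .bot :=
  h.of_mem_jointLaws (G := .fml (Fml.oc .bot).neg) (by simp [jointLaws])

theorem wn_ex_le (A : Fml .i) : Le Γ (.wn (.ex A)) (.ex (.wn A)) := by
  have H := (h.of_mem_jointLaws (G := .all2 .i 1
    (.fml (.wn (.ex (at1 .i 0 0)) ⇌ .ex (.wn (at1 .i 0 0))))) (by simp [jointLaws])).all2E A
  have e : A.rename (fun j => instVar 0 (if j = 0 then j else j + 1)) = A :=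
    Fml.rename_eq _ fun j => by rcases j with _ | j <;> simp [instVar]
  simp [MFml.subst, Fml.subst, Fml.iff, Fml.rename_rename] at H
  rw [e] at H
  exact h.le_of_iff H

theorem wn_and_wn_neg_le (A : Fml .i) (B : Fml .c) : Le Γ (.wn A ⋏ .wn A.neg) B :=
  h.trans (h.wn_and_le A A.neg) (h.trans (h.wn_mono (h.and_neg_le A .bot))
    (h.trans h.wn_bot_le (h.bot_le B)))

/-! ### Monotonicity of the quantifiers -/

theorem all_mono {A B : Fml s} (H : Le Γ A B) : Le Γ (.all A) (.all B) :=
  h.le_all (h.trans (h.rename_all_le A) H)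

theorem ex_mono {A B : Fml s} (H : Le Γ A B) : Le Γ (.ex A) (.ex B) :=
  h.ex_le (h.trans H (h.le_rename_ex B))

theorem box_all_le (A : Fml .c) : Le Γ (Fml.all A).box (.all A.box) :=
  h.le_all (h.box_mono (h.rename_all_le A))

theorem ex_box_le (A : Fml .c) : Le Γ (.ex A.box) (Fml.ex A).box :=
  h.ex_le (h.box_mono (h.le_rename_ex A))

theorem nabla_all_le (A : Fml .i) : Le Γ (Fml.all A).nabla (.all A.nabla) :=
  h.le_all (h.nabla_mono (h.rename_all_le A))

theorem ex_nabla_le (A : Fml .i) : Le Γ (.ex A.nabla) (Fml.ex A).nabla :=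
  h.ex_le (h.nabla_mono (h.le_rename_ex A))

end IsTheory

end QHC

namespace QHC

namespace IsTheory

variable {Γ : List MFml} (h : IsTheory Γ)
include h

/-! ### Consequences of K -/

theorem neg_anti {s : Kind} {A B : Fml s} (H : Le Γ A B) : Le Γ B.neg A.neg :=
  h.imp_of_le H (h.refl _)

theorem neg_and_le {s : Kind} (A B : Fml s) : Le Γ (A.neg ⋏ A) B :=
  h.trans (h.le_and (h.and_le_right _ _) (h.and_le_left _ _)) (h.and_neg_le A B)

theorem neg_neg_le (A : Fml .c) : Le Γ A.neg.neg A :=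
  h.le_of_cases (h.em A) (h.and_le_right _ _) (h.neg_and_le _ _)

theorem oc_neg_wn_le (A : Fml .i) : Le Γ (.oc (Fml.wn A).neg) A.neg :=
  h.trans (h.oc_imp_le _ _) (h.imp_of_le (h.le_nabla A) h.oc_bot_le)

theorem H_of_K (hK : ∀ p : Fml .c, Le Γ (Fml.oc p.neg).neg (.oc p)) (A : Fml .i) :
    Der Γ (.fml (.wn (A ⋎ A.neg))) := by
  have key : Le Γ (.oc (Fml.wn (A ⋎ A.neg)).neg) .bot :=
    h.trans (h.le_and
      (h.trans (h.oc_mono (h.neg_anti (h.wn_mono (h.le_or_left _ _)))) (h.oc_neg_wn_le A))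
      (h.trans (h.oc_mono (h.neg_anti (h.wn_mono (h.le_or_right _ _)))) (h.oc_neg_wn_le A.neg)))
      (h.and_neg_le _ _)
  exact h.of_oc (h.mp (hK _) key)

/-- Under K the operator `□` is the identity. -/
theorem le_box_of_K (hK : ∀ p : Fml .c, Le Γ (Fml.oc p.neg).neg (.oc p)) (A : Fml .c) :
    Le Γ A A.box := by
  refine h.le_of_cases (h.mp (h.wn_or_le _ _) (h.H_of_K hK (.oc A))) (h.and_le_right _ _) ?_
  have key : Le Γ (Fml.oc A).neg (.oc A.neg) :=
    h.trans (h.neg_anti (h.oc_mono (h.neg_neg_le A))) (hK A.neg)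
  exact h.trans (h.le_and (h.and_le_left _ _)
    (h.trans (h.and_le_right _ _) (h.trans (h.wn_mono key) (h.box_le _)))) (h.and_neg_le _ _)

theorem exBox_of_K (hK : ∀ p : Fml .c, Le Γ (Fml.oc p.neg).neg (.oc p)) (A : Fml .c) :
    Le Γ (Fml.ex A).box (.ex A.box) :=
  h.trans (h.box_le _) (h.ex_mono (h.le_box_of_K hK A))

/-! ### Consequences of H -/

theorem R_of_H (hH : ∀ A : Fml .i, Der Γ (.fml (.wn (A ⋎ A.neg)))) (A B : Fml .i) :
    Le Γ (A.nabla ⇾ B.nabla) (A ⇾ B).nabla := by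
  have key : Le Γ (.wn (A.nabla ⇾ B.nabla)) (.wn A ⇾ .wn B) :=
    h.trans (h.wn_imp_le _ _) (h.imp_of_le (h.wn_mono (h.le_nabla A)) (h.wn_nabla_le B))
  refine h.le_oc (h.le_of_cases (h.mp (h.wn_or_le _ _) (hH A)) ?_ ?_)
  · exact h.trans (h.and_le key) (h.wn_mono (h.imp_const B A))
  · exact h.trans (h.and_le_right _ _) (h.wn_mono (h.imp_of_le (h.refl A) (h.bot_le B)))

/-- With `E = ∃x ¬!A(x)`, H gives `?E ∨ ?¬E`. The first alternative contradicts `∀x □A(x)`, the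
second one implies `□∀x A(x)`. -/
theorem allBox_of_H (hH : ∀ A : Fml .i, Der Γ (.fml (.wn (A ⋎ A.neg)))) (A : Fml .c) :
    Le Γ (.all A.box) (Fml.all A).box := by
  refine h.le_of_cases (h.mp (h.wn_or_le _ _) (hH (.ex (Fml.oc A).neg))) ?_ ?_
  · have key : Le Γ (.wn (Fml.oc A).neg) ((Fml.all A.box).neg.rename Nat.succ) :=
      h.le_imp (h.trans (h.le_and (h.trans (h.and_le_right _ _) (h.rename_all_le A.box))
        (h.and_le_left _ _)) (h.wn_and_wn_neg_le (.oc A) .bot))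
    exact h.trans (h.le_and (h.and_le_left _ _)
      (h.trans (h.and_le_right _ _) (h.trans (h.wn_ex_le _) (h.ex_le key)))) (h.and_neg_le _ _)
  · have key : Le Γ (.wn (Fml.oc A).neg.neg) A := by
      refine h.trans (h.le_of_cases (h.mp (h.wn_or_le _ _) (hH (.oc A))) (h.and_le_right _ _) ?_)
        (h.box_le A)
      exact h.trans (h.le_and (h.and_le_right _ _) (h.and_le_left _ _)) (h.wn_and_wn_neg_le _ _)
    refine h.trans (h.and_le_right _ _) (h.wn_mono (h.le_oc (h.le_all ?_)))
    exact h.trans (h.wn_mono (h.neg_anti (h.le_rename_ex (Fml.oc A).neg))) key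

/-! ### From `∃` to `∀` under `□` -/

theorem neg_imp_le (A B : Fml .c) : Le Γ (A ⇾ B).neg A := by
  refine h.le_of_cases (h.em A) (h.and_le_right _ _) ?_
  exact h.trans (h.le_and (h.and_le_left _ _)
    (h.trans (h.and_le_right _ _) (h.imp_of_le (h.refl A) (h.bot_le B)))) (h.neg_and_le _ _)

/-- The drinker's principle `∃x (A(x) → ∀y A(y))` of classical logic. -/
theorem drinker (A : Fml .c) : Der Γ (.fml (.ex (A ⇾ (Fml.all A).rename Nat.succ))) := by
  refine h.mp (h.or_le (h.refl _) ?_) (h.em (.ex (A ⇾ (Fml.all A).rename Nat.succ)))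
  have h₁ : Le Γ (Fml.ex (A ⇾ (Fml.all A).rename Nat.succ)).neg (.all A) :=
    h.le_all (h.trans (h.neg_anti (h.le_rename_ex _)) (h.neg_imp_le A _))
  have e : ((Fml.all A).rename Nat.succ).rename (instVar 0) = .all A := by
    rw [Fml.rename_rename]
    exact Fml.rename_eq _ fun _ => rfl
  have h₂ := h.le_ex (A ⇾ (Fml.all A).rename Nat.succ) 0
  rw [Fml.rename, e] at h₂
  exact h.trans h₁ (h.trans (h.imp_const _ _) h₂)

/-- The drinker's principle is necessary, and `∃` commutes with `□` by assumption. -/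
theorem allBox_of_exBox (hE : ∀ A : Fml .c, Le Γ (Fml.ex A).box (.ex A.box)) (A : Fml .c) :
    Le Γ (.all A.box) (Fml.all A).box := by
  have key : Le Γ (A ⇾ (Fml.all A).rename Nat.succ).box
      ((Fml.all A.box ⇾ (Fml.all A).box).rename Nat.succ) :=
    h.trans (h.wn_mono (h.oc_imp_le _ _)) (h.trans (h.wn_imp_le _ _)
      (h.imp_of_le (h.rename_all_le A.box) (h.refl _)))
  exact h.mp (h.ex_le key) (h.mp (hE _) (h.wn_of (h.oc_of (h.drinker A))))

end IsTheory

/-! ### The arrows of the diagram -/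

theorem Law.isTheory (P : Law) : IsTheory [P.meta, system] where
  system := .hyp (by simp)
  closed := by simp [P.closed_meta.rename, closed_system.rename]

theorem Law.map_subst (P : Law) (σ : PSubst) :
    [P.meta, system].map (MFml.subst σ) = [P.meta, system] := by
  simp [P.closed_meta.subst, closed_system.subst]

theorem Law.der_all2 {P : Law} {s : Kind} {n : ℕ} {F : MFml} (H : Der [P.meta, system] F) :
    Der [P.meta, system] (.all2 s n F) :=
  .all2I ((P.map_subst (shiftSubst s n)).symm ▸ H)

theorem Der.weaken {Γ : List MFml} {F : MFml} (H : Der Γ F) :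
    ∀ {Δ : List MFml}, Γ ⊆ Δ → Der Δ F := by
  induction H with
  | hyp hF => exact fun h => .hyp (h hF)
  | andI _ _ ih₁ ih₂ => exact fun h => .andI (ih₁ h) (ih₂ h)
  | andE₁ _ ih => exact fun h => .andE₁ (ih h)
  | andE₂ _ ih => exact fun h => .andE₂ (ih h)
  | impI _ ih => exact fun h => .impI (ih (List.cons_subset_cons _ h))
  | impE _ _ ih₁ ih₂ => exact fun h => .impE (ih₁ h) (ih₂ h)
  | all1I _ ih => exact fun h => .all1I (ih (List.map_subset _ h))
  | all1E x _ ih => exact fun h => .all1E x (ih h)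
  | all2I _ ih => exact fun h => .all2I (ih (List.map_subset _ h))
  | all2E A _ ih => exact fun h => .all2E A (ih h)

theorem Implies.intro {F G : MFml} (H : Der [F, system] G) : Implies F G := .impI (.impI H)

theorem Implies.trans {F G K : MFml} (h₁ : Implies F G) (h₂ : Implies G K) : Implies F K := by
  have hS : Der [F, system] system := .hyp (by simp)
  have hF : Der [F, system] F := .hyp (by simp)
  have hG := ((Der.weaken h₁ (by simp)).impE hS).impE hF
  exact .intro (((Der.weaken h₂ (by simp)).impE hS).impE hG)

theorem Implies.refl (F : MFml) : Implies F F := .intro (.hyp (by simp))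

theorem Derivable.implies {F : MFml} (h : Derivable F) (G : MFml) : Implies G F :=
  .intro ((Der.weaken h (by simp)).impE (.hyp (by simp)))

theorem Law.schema_K : ∀ p : Fml .c, Le [Law.K.meta, system] (Fml.oc p.neg).neg (.oc p) := by
  intro p
  have H : Der [Law.K.meta, system] Law.K.meta := .hyp (by simp)
  simpa [MFml.subst, Fml.subst, Fml.neg] using H.all2E p

theorem Law.schema_H : ∀ A : Fml .i, Der [Law.H.meta, system] (.fml (.wn (A ⋎ A.neg))) := by
  intro A
  have H : Der [Law.H.meta, system] Law.H.meta := .hyp (by simp)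
  simpa [MFml.subst, Fml.subst, Fml.neg] using H.all2E A

theorem Law.schema_PC {Γ : List MFml} (H : Der Γ Law.PC.meta) (A : Fml .i) : Le Γ A.nabla A := by
  simpa [MFml.subst, Fml.subst, Fml.nabla] using H.all2E A

theorem Law.schema_exBox :
    ∀ A : Fml .c, Le [Law.exBox.meta, system] (Fml.ex A).box (.ex A.box) := by
  intro A
  have H : Der [Law.exBox.meta, system] Law.exBox.meta := .hyp (by simp)
  have H := H.all2E A
  have e : A.rename (fun j => instVar 0 (if j = 0 then j else j + 1)) = A :=
    Fml.rename_eq _ fun j => by rcases j with _ | j <;> simp [instVar]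
  simp [MFml.subst, Fml.subst, Fml.iff, Fml.box, Fml.rename_rename] at H
  rw [e] at H
  exact Law.exBox.isTheory.le_of_iff H

theorem Arrow.implies {P Q : Law} (a : Arrow P Q) : Implies P.meta Q.meta := by
  refine .intro ?_
  cases a
  · exact Law.der_all2 (Law.K.isTheory.H_of_K Law.schema_K _)
  · exact Law.der_all2 (Law.K.isTheory.iff_of_le (Law.K.isTheory.exBox_of_K Law.schema_K _)
      (Law.K.isTheory.ex_box_le _))
  · exact Law.der_all2 (Law.der_all2 (Law.H.isTheory.R_of_H Law.schema_H _ _))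
  · exact Law.der_all2 (Law.H.isTheory.iff_of_le (Law.H.isTheory.allBox_of_H Law.schema_H _)
      (Law.H.isTheory.box_all_le _))
  · exact Law.der_all2 (Law.exBox.isTheory.iff_of_le
      (Law.exBox.isTheory.allBox_of_exBox Law.schema_exBox _) (Law.exBox.isTheory.box_all_le _))
  · refine Law.der_all2 (.impI ?_)
    have h : IsTheory [.fml (at0 .i 0).nabla, Law.PC.meta, system] :=
      ⟨.hyp (by simp), by
        simp [(Law.closed_meta _).rename, closed_system.rename, MFml.rename, Fml.rename,
          Fml.nabla]⟩
    exact h.mp (Law.schema_PC (.hyp (by simp)) _) (.hyp (by simp))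
  all_goals
    have h := Law.PC.isTheory
    have hPC (A : Fml .i) : Le [Law.PC.meta, system] A.nabla A := Law.schema_PC (.hyp (by simp)) A
  · exact Law.der_all2 (Law.der_all2 (h.trans (h.imp_of_le (h.le_nabla _) (hPC _)) (h.le_nabla _)))
  · exact Law.der_all2 (Law.der_all2 (h.trans (hPC _) (h.or_le
      (h.trans (h.le_nabla _) (h.le_or_left _ _)) (h.trans (h.le_nabla _) (h.le_or_right _ _)))))
  · exact Law.der_all2 (h.iff_of_le (h.nabla_all_le _)
      (h.trans (h.all_mono (hPC _)) (h.le_nabla _)))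
  · exact Law.der_all2 (h.iff_of_le (h.ex_nabla_le _)
      (h.trans (hPC _) (h.ex_mono (h.le_nabla _))))

theorem implies_edPrinciple_of_D : Implies Law.D.meta edPrinciple := by
  have h := Law.D.isTheory
  have H : Der [Law.D.meta, system] Law.D.meta := .hyp (by simp)
  have H := (H.all2E (at0 .i 1)).all2E (at0 .i 0)
  simp [MFml.subst, Fml.subst, Fml.nabla] at H
  exact .intro (Law.der_all2 (Law.der_all2 (h.of_true _ H)))

theorem implies_of_reflTransGen {P Q : Law} (H : Relation.ReflTransGen Arrow P Q) :
    Implies P.meta Q.meta := by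
  induction H with
  | refl => exact .refl _
  | tail _ a ih => exact ih.trans a.implies

/-! ### Completeness of the diagram -/

namespace Law

instance : DecidableEq Law := fun P Q => decidable_of_iff (P.ctorIdx = Q.ctorIdx)
  ⟨fun h => by cases P <;> cases Q <;> first | rfl | simp [Law.ctorIdx] at h, congrArg _⟩

/-- The laws that can be reached from a given one along the arrows of the diagram. -/
def consequences : Law → List Law
  | .K => [.K, .H, .exBox, .R, .allBox]
  | .H => [.H, .R, .allBox]
  | .exBox => [.exBox, .allBox]
  | .PC => [.PC, .PCRule, .R, .D, .allNabla, .exNabla]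
  | P => [P]

/-- Laws that are refuted in some model of a given one. These are enough to refute all
implications that do not follow from the diagram. -/
def nonconsequences : Law → List Law
  | .K => [.PCRule, .D, .allNabla, .exNabla]
  | .H => [.exBox]
  | .exBox => [.R]
  | .PC => [.allBox]
  | .D => [.R, .allNabla, .exNabla, .PCRule]
  | .allNabla => [.R, .D, .exNabla, .PCRule]
  | .exNabla => [.R, .D, .allNabla, .PCRule]
  | .PCRule => [.R, .D, .allNabla, .exNabla]
  | _ => []

theorem reflTransGen_of_mem {P Q : Law} (h : Q ∈ P.consequences) :
    Relation.ReflTransGen Arrow P Q := by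
  cases P <;> simp only [consequences, List.mem_cons, List.not_mem_nil, or_false] at h
  case K =>
    rcases h with rfl | rfl | rfl | rfl | rfl
    exacts [.refl, .single .K_H, .single .K_exBox, .tail (.single .K_H) .H_R,
      .tail (.single .K_H) .H_allBox]
  case H =>
    rcases h with rfl | rfl | rfl
    exacts [.refl, .single .H_R, .single .H_allBox]
  case exBox =>
    rcases h with rfl | rfl
    exacts [.refl, .single .exBox_allBox]
  case PC =>
    rcases h with rfl | rfl | rfl | rfl | rfl | rfl
    exacts [.refl, .single .PC_PCRule, .single .PC_R, .single .PC_D, .single .PC_allNabla,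
      .single .PC_exNabla]
  all_goals exact h ▸ .refl

theorem not_implies {M : Model} {D : Type} [Nonempty D] {F G : MFml} (hF : M.Valid D F)
    (hG : ¬ M.Valid D G) : ¬ Implies F G :=
  fun h => hG (h.valid hF)

open Model in
theorem not_implies_of_mem {P Q : Law} (h : Q ∈ P.nonconsequences) :
    ¬ Implies P.meta Q.meta := by
  have hl : Fork.left ∈ ({Fork.left, Fork.right} : Set Fork) := by simp
  have hr : Fork.right ∈ ({Fork.left, Fork.right} : Set Fork) := by simp
  have hn : Fork.root ∉ ({Fork.left, Fork.right} : Set Fork) := by simp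
  have hl' : Fork.left ∈ ({Fork.root}ᶜ : Set Fork) := by simp
  have hr' : Fork.right ∈ ({Fork.root}ᶜ : Set Fork) := by simp
  have hn' : Fork.root ∉ ({Fork.root}ᶜ : Set Fork) := by simp
  cases P <;> simp only [nonconsequences, List.mem_cons, List.not_mem_nil, or_false] at h
  case K =>
    rcases h with rfl | rfl | rfl | rfl
    · exact not_implies valid_K_const.1 (not_valid_PCRule_const Unit)
    · exact not_implies (valid_K_leaves Unit) (not_valid_D_fork hl hr hn Unit)
    · exact not_implies valid_K_const.2 (not_valid_allNabla_chain fun _ => .inl rfl)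
    · exact not_implies (valid_K_leaves Bool) (not_valid_exNabla_fork hl hr hn)
  case H =>
    exact h ▸ not_implies (valid_H_const Bool) not_valid_exBox_const
  case exBox =>
    exact h ▸ not_implies (valid_exBox_unit gap) (not_valid_R_gap Unit)
  case PC =>
    obtain ⟨M, D, _, h₁, h₂⟩ := exists_not_valid_allBox
    exact h ▸ not_implies h₁ h₂
  case D =>
    rcases h with rfl | rfl | rfl | rfl
    · exact not_implies (valid_D_chain Unit) (not_valid_R_gap Unit)
    · exact not_implies (M := const Unit) (valid_D_chain PosDom)
        (not_valid_allNabla_chain fun _ => .inl rfl)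
    · obtain ⟨M, D, _, h₁, h₂⟩ := exists_not_valid_exNabla
      exact not_implies h₁ h₂
    · exact not_implies (valid_D_chain Unit) (not_valid_PCRule_const (X := Unit) Unit)
  case allNabla =>
    rcases h with rfl | rfl | rfl | rfl
    · exact not_implies (valid_allNabla_unit gap) (not_valid_R_gap Unit)
    · exact not_implies (valid_allNabla_unit leaves) (not_valid_D_fork hl hr hn Unit)
    · exact not_implies (M := leaves) (valid_allNabla_kripke Bool) (not_valid_exNabla_fork hl hr hn)
    · exact not_implies (valid_allNabla_unit (const Unit)) (not_valid_PCRule_const Unit)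
  case exNabla =>
    rcases h with rfl | rfl | rfl | rfl
    · exact not_implies (valid_exNabla_unit gap) (not_valid_R_gap Unit)
    · exact not_implies (valid_exNabla_unit leaves) (not_valid_D_fork hl hr hn Unit)
    · exact not_implies (valid_exNabla_const (X := Unit) PosDom)
        (not_valid_allNabla_chain fun _ => .inl rfl)
    · exact not_implies (valid_exNabla_unit (const Unit)) (not_valid_PCRule_const Unit)
  case PCRule =>
    rcases h with rfl | rfl | rfl | rfl
    · exact not_implies (valid_PCRule_gap Unit) (not_valid_R_gap Unit)
    · exact not_implies (valid_PCRule_rootless Unit) (not_valid_D_fork hl' hr' hn' Unit)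
    · exact not_implies (valid_PCRule_gap PosDom)
        (not_valid_allNabla_chain fun x => x.2.2)
    · exact not_implies (valid_PCRule_rootless Bool) (not_valid_exNabla_fork hl' hr' hn')

/-- The two tables are complementary: `Q` is a consequence of `P`, or some `P'` above `P` fails to
imply some `Q'` below `Q`. -/
theorem mem_consequences_or (P Q : Law) : Q ∈ P.consequences ∨
    ∃ P' ∈ [Law.K, .H, .exBox, .PC, .D, .allNabla, .exNabla, .PCRule], P ∈ P'.consequences ∧
      ∃ Q' ∈ Q.consequences, Q' ∈ P'.nonconsequences := by
  cases P <;> cases Q <;> decide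

theorem implies_iff (P Q : Law) :
    Implies P.meta Q.meta ↔ Relation.ReflTransGen Arrow P Q := by
  refine ⟨fun h => ?_, implies_of_reflTransGen⟩
  rcases mem_consequences_or P Q with hPQ | ⟨P', -, hP, Q', hQ, hn⟩
  · exact reflTransGen_of_mem hPQ
  · exact absurd ((implies_of_reflTransGen (reflTransGen_of_mem hP)).trans
      (h.trans (implies_of_reflTransGen (reflTransGen_of_mem hQ)))) (not_implies_of_mem hn)

theorem not_derivable (Q : Law) : ¬ Derivable Q.meta := by
  have key : ∃ P ∈ [Law.K, .PC, .D], ∃ Q' ∈ Q.consequences, Q' ∈ P.nonconsequences := by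
    cases Q <;> decide
  obtain ⟨P, -, Q', hQ, hn⟩ := key
  exact fun h => not_implies_of_mem hn
    ((h.implies _).trans (implies_of_reflTransGen (reflTransGen_of_mem hQ)))

open Model in
theorem not_valid_edPrinciple_leaves : ¬ leaves.Valid Unit edPrinciple :=
  not_valid_edPrinciple_fork (by simp) (by simp) (by simp) Unit

open Model in
theorem implies_edPrinciple_iff {P : Law} (hP : P ≠ .PCRule) :
    Implies P.meta edPrinciple ↔ P = .D ∨ P = .PC := by
  have hK : ¬ Implies Law.K.meta edPrinciple :=
    not_implies (valid_K_leaves Unit) not_valid_edPrinciple_leaves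
  have of_K {P : Law} (h : P ∈ Law.K.consequences) : ¬ Implies P.meta edPrinciple :=
    fun h' => hK ((implies_of_reflTransGen (reflTransGen_of_mem h)).trans h')
  constructor
  · intro h
    cases P
    case D => exact .inl rfl
    case PC => exact .inr rfl
    case PCRule => exact absurd rfl hP
    case allNabla =>
      exact absurd h (not_implies (valid_allNabla_unit leaves) not_valid_edPrinciple_leaves)
    case exNabla =>
      exact absurd h (not_implies (valid_exNabla_unit leaves) not_valid_edPrinciple_leaves)
    all_goals exact absurd h (of_K (by decide))
  · rintro (rfl | rfl)
    · exact implies_edPrinciple_of_D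
    · exact Arrow.PC_D.implies.trans implies_edPrinciple_of_D

end Law

end QHC

theorem mainTheorem4 :
    ((∀ P : QHC.Law, ¬ QHC.Derivable P.meta) ∧
      (∀ P Q : QHC.Law,
        QHC.Implies P.meta Q.meta ↔ Relation.ReflTransGen QHC.Arrow P Q)) ∧
    (¬ QHC.Derivable QHC.edPrinciple ∧
      (∀ P : QHC.Law, P ≠ QHC.Law.PCRule →
        (QHC.Implies P.meta QHC.edPrinciple ↔ P = QHC.Law.D ∨ P = QHC.Law.PC))) :=
  ⟨⟨QHC.Law.not_derivable, QHC.Law.implies_iff⟩,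
    fun h => QHC.Law.not_valid_edPrinciple_leaves h.valid,
    fun _ hP => QHC.Law.implies_edPrinciple_iff hP⟩
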